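/- Let $n\ge 1$. For a measurable exponent $p:\mathbb R^n\to(0,\infty)$ put $p^-=\operatorname{ess\,inf}p$, $p^+=\operatorname{ess\,sup}p$. Let $L^{p(\cdot)}$ be the set of measurable functions $f$ on $\mathbb R^n$ with $\int_{\mathbb R^n}(|f(x)|/\lambda)^{p(x)}\,dx<\infty$ for some $\lambda>0$, and let $$\|f\|_{p(\cdot)}=\inf\Big\{\lambda>0:\int_{\mathbb R^n}(|f(x)|/\lambda)^{p(x)}\,dx\le 1\Big\}\qquad(\inf\emptyset=\infty).$$ Let $Mf(x)=\sup_{r>0}\frac1{|B(x,r)|}\int_{B(x,r)}|f(y)|\,dy$ be the Hardy–Littlewood maximal function. A weight is a non-negative locally integrable function $w$ on $\mathbb R^n$; for $1<q<\infty$ its $A_q$ constant is $$[w]_{A_q}=\sup_Q\Big(\frac1{|Q|}\int_Q w\Big)\Big(\frac1{|Q|}\int_Q w^{1-q'}\Big)^{q-1},\qquad \frac1q+\frac1{q'}=1,$$ the supremum being over all cubes $Q$ with sides parallel to the axes, and $w\in A_q$ means $[w]_{A_q}<\infty$. Let $\mathcal F$ be a family of pairs $(f,g)$ of non-negative measurable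 functions on $\mathbb R^n$ with values in $[0,\infty]$, and let $0<\delta<1$ and $1<p_0<\infty$. Suppose that for every $K\ge 0$ there is a finite constant $C_0(K)$ such that for all weights $w\in A_{p_0}$ with $[w]_{A_{p_0}}\le K$ $$\int_{\mathbb R^n} f(x)^{p_0}w(x)^{\delta}\,dx\le C_0(K)\int_{\mathbb R^n} g(x)^{p_0}w(x)^{\delta}\,dx$$ for every $(f,g)\in\mathcal F$ whose left-hand side is finite. Let $p(\cdot)$ be a measurable exponent and $p_*$ a number with $$\frac{p_0}{1+\delta(p_0-1)}<p_*<p^-\le p^+<\frac{p_0}{1-\delta},$$ and put $\delta_*=\frac{p_0-p_*(1-\delta)}{p_0}$. Assume that $M$ is bounded on $L^{q(\cdot)}$, where $$q(x)=\delta_*\Big(\frac{p(x)}{p_*}\Big)'=\delta_*\,\frac{p(x)}{p(x)-p_*}.$$ Then there is a finite constant $C$, independent of the pair, such that for all $(f,g)\in\mathcal F$ with $f\in L^{p(\cdot)}$ $$\|f\|_{p(\cdot)}\le C\,\|g\|_{p(\cdot)}.$$ -/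

import Mathlib

open MeasureTheory
open scoped ENNReal NNReal

noncomputable section

namespace VarLebesgue

/-- Euclidean space of dimension `n`, with the Euclidean norm and Lebesgue measure. -/
abbrev Rn (n : ℕ) : Type := EuclideanSpace ℝ (Fin n)

/-! Non-negative functions take values in `[0, ∞]`, and all integrals of them are Lebesgue
integrals with values in `[0, ∞]`. Since the norms and the maximal operator below depend only on
absolute values, this loses nothing. -/

/-- The modular `∫ f(x) ^ p(x) dx` of a non-negative function. -/
def modular {n : ℕ} (p : Rn n → ℝ) (f : Rn n → ℝ≥0∞) : ℝ≥0∞ :=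
  ∫⁻ x, f x ^ p x

/-- `f ∈ L^{p(·)}`, for a non-negative `f`: it is measurable and `∫ (f(x)/t)^{p(x)} dx < ∞` for
some `t > 0`. -/
def MemLpVar {n : ℕ} (p : Rn n → ℝ) (f : Rn n → ℝ≥0∞) : Prop :=
  Measurable f ∧ ∃ t : ℝ, 0 < t ∧ modular p (fun x => f x / ENNReal.ofReal t) < ∞

/-- The Luxemburg norm `inf {t > 0 : ∫ (f(x)/t)^{p(x)} dx ≤ 1}` of a non-negative function; it is
`∞` when there is no such `t`. -/
def lpNorm {n : ℕ} (p : Rn n → ℝ) (f : Rn n → ℝ≥0∞) : ℝ≥0∞ :=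
  ⨅ (t : ℝ) (_ : 0 < t) (_ : modular p (fun x => f x / ENNReal.ofReal t) ≤ 1), ENNReal.ofReal t

/-- The essential infimum `p^-` of a non-negative exponent function, as an element of `[0, ∞]`. -/
def pMinus {n : ℕ} (p : Rn n → ℝ) : ℝ≥0∞ := essInf (fun x => ENNReal.ofReal (p x)) volume

/-- The essential supremum `p^+` of a non-negative exponent function, as an element of
`[0, ∞]`. -/
def pPlus {n : ℕ} (p : Rn n → ℝ) : ℝ≥0∞ := essSup (fun x => ENNReal.ofReal (p x)) volume

/-- The average `(1/|E|) ∫_E f` over a set `E` of positive finite measure. -/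
def avg {n : ℕ} (E : Set (Rn n)) (f : Rn n → ℝ≥0∞) : ℝ≥0∞ := (volume E)⁻¹ * ∫⁻ x in E, f x

/-- The centered Hardy-Littlewood maximal function over Euclidean balls. -/
def maximal {n : ℕ} (f : Rn n → ℝ≥0∞) (x : Rn n) : ℝ≥0∞ :=
  ⨆ (r : ℝ) (_ : 0 < r), avg (Metric.ball x r) f

/-- The Hardy-Littlewood maximal operator is bounded on `L^{q(·)}`. -/
def MaximalBounded {n : ℕ} (q : Rn n → ℝ) : Prop :=
  ∃ C : ℝ≥0, ∀ h : Rn n → ℝ≥0∞, MemLpVar q h → lpNorm q (maximal h) ≤ C * lpNorm q h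

/-- The cube with sides parallel to the axes, lower corner `a` and side length `l`. -/
def cube {n : ℕ} (a : Rn n) (l : ℝ) : Set (Rn n) := {x | ∀ i, x i ∈ Set.Icc (a i) (a i + l)}

/-- A weight: a non-negative, locally integrable function. -/
def IsWeight {n : ℕ} (w : Rn n → ℝ≥0) : Prop :=
  LocallyIntegrable (fun x => (w x : ℝ)) volume

/-- The `A_p` constant of `w`, `1 < p < ∞`: the supremum over all cubes of
`(⨍ w) (⨍ w^{1-p'})^{p-1}`, where `p' = p/(p-1)`. The power `w^{1-p'}`, whose exponent is negative,
is `∞` where `w = 0`. -/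
def apConst {n : ℕ} (p : ℝ) (w : Rn n → ℝ≥0) : ℝ≥0∞ :=
  ⨆ (a : Rn n) (l : ℝ) (_ : 0 < l),
    avg (cube a l) (fun x => (w x : ℝ≥0∞)) *
      (avg (cube a l) (fun x => (w x : ℝ≥0∞) ^ (1 - p.conjExponent))) ^ (p - 1)

/-- The inequality `∫ f^{p₀} w^δ ≤ C₀ ∫ g^{p₀} w^δ` holds for all `(f, g) ∈ F` and all `w ∈ A_{p₀}`.
By convention it is required only when the left-hand side is finite, and `C₀` depends
on `w` only through its `A_{p₀}` constant: `C₀ K` works for every weight whose `A_{p₀}` constant is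
at most `K`. -/
def WeightedIneq {n : ℕ} (F : Set ((Rn n → ℝ≥0∞) × (Rn n → ℝ≥0∞))) (p₀ δ : ℝ) : Prop :=
  ∃ C₀ : ℝ≥0 → ℝ≥0, ∀ (K : ℝ≥0) (w : Rn n → ℝ≥0), IsWeight w → apConst p₀ w ≤ K →
    ∀ f g : Rn n → ℝ≥0∞, (f, g) ∈ F →
      (∫⁻ x, f x ^ p₀ * (w x : ℝ≥0∞) ^ δ) < ∞ →
      (∫⁻ x, f x ^ p₀ * (w x : ℝ≥0∞) ^ δ) ≤ C₀ K * ∫⁻ x, g x ^ p₀ * (w x : ℝ≥0∞) ^ δ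

end VarLebesgue

end

/-! The variable exponent is reached from a constant one by duality. Scale `f` to `φ` with modular
between `1` and a constant. Then `φ ^ p = φ ^ ps * h ^ δs` with `h = φ ^ ((p - ps) / δs)`, and `h ^
q = φ ^ p` because `q` is `δs` times the conjugate of `p / ps`. So `h` belongs to the space where
`M` is bounded, and the Rubio de Francia iteration replaces it by an `A₁` weight `V` of controlled
modular (`exists_isA1_test`). An inequality at the constant exponent `ps` with weight `V ^ δs`
passes from `f` to `g`, and Young's inequality (`rpow_mul_rpow_le_add`) bounds the `g` side by
modulars.

The inequality at `ps` (`exists_extrapolation`) comes from the one at `p₀`, tested on weights `u * v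
^ (1 - p₀)` with `u`, `v` in `A₁` (`IsFat.ap_le`). For `ps < p₀` the weight is `H * V ^ (1 - p₀)`,
for `ps > p₀` it is `V`, where `V` is an `A₁` majorant built from the functions and `H`; Hölder's
inequality pays for the change of exponent. Each use of the hypothesis requires a proof that the
left-hand side is finite.

These majorants need `M` bounded on `L^r(w)` with a constant depending only on the `A_r` constant.
Lerner's argument dominates `M` by two centered maximal operators, for the dual weight and for `w`;
these are bounded uniformly in the measure, since Besicovitch's covering theorem needs no doubling.
-/

namespace VarLebesgue

variable {n : ℕ}

/-! ### The maximal operator -/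

/-- A ball is the increasing union of concentric smaller ones; one of these already has measure
above `c` and stays inside the ball of radius `r` about every nearby centre. Both maximal functions
are thereby measurable, whatever function is averaged. -/
theorem lowerSemicontinuous_measure_ball (ν : Measure (Rn n)) (r : ℝ) :
    LowerSemicontinuous fun x => ν (Metric.ball x r) := by
  intro x c hc
  have hU : Metric.ball x r = ⋃ k : ℕ, Metric.ball x (r - 1 / ((k : ℝ) + 1)) := by
    ext y
    simp only [Metric.mem_ball, Set.mem_iUnion]
    constructor
    · intro h
      obtain ⟨k, hk⟩ := exists_nat_one_div_lt (sub_pos.2 h)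
      exact ⟨k, by linarith⟩
    · rintro ⟨k, hk⟩
      have : (0 : ℝ) < 1 / ((k : ℝ) + 1) := by positivity
      linarith
  have hmono : Monotone fun k : ℕ => Metric.ball x (r - 1 / ((k : ℝ) + 1)) := by
    intro a b hab
    apply Metric.ball_subset_ball
    have : 1 / ((b : ℝ) + 1) ≤ 1 / ((a : ℝ) + 1) := by gcongr
    linarith
  have hc' : c < ν (Metric.ball x r) := hc
  rw [hU, hmono.directed_le.measure_iUnion, lt_iSup_iff] at hc'
  obtain ⟨k, hk⟩ := hc'
  have hpos : (0 : ℝ) < 1 / ((k : ℝ) + 1) := by positivity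
  filter_upwards [Metric.ball_mem_nhds x hpos] with y hy
  refine hk.trans_le (measure_mono (Metric.ball_subset_ball' ?_))
  rw [Metric.mem_ball, dist_comm] at hy
  linarith

theorem lintegral_ball_eq_withDensity (μ : Measure (Rn n)) (f : Rn n → ℝ≥0∞) (x : Rn n) (r : ℝ) :
    ∫⁻ y in Metric.ball x r, f y ∂μ = (μ.withDensity f) (Metric.ball x r) :=
  (withDensity_apply _ Metric.isOpen_ball.measurableSet).symm

theorem volume_ball_pos (x : Rn n) {r : ℝ} (hr : 0 < r) : volume (Metric.ball x r) ≠ 0 :=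
  (Metric.measure_ball_pos _ _ hr).ne'

theorem volume_ball_ne_top (x : Rn n) (r : ℝ) : volume (Metric.ball x r) ≠ ∞ :=
  measure_ball_lt_top.ne

theorem volume_ball_mul (x y : Rn n) {c : ℝ} (hc : 0 < c) (r : ℝ) :
    volume (Metric.ball x (c * r)) = ENNReal.ofReal (c ^ n) * volume (Metric.ball y r) := by
  rw [Measure.addHaar_ball_mul_of_pos _ _ hc, finrank_euclideanSpace_fin,
    Measure.addHaar_ball_center volume y]

theorem measurable_maximal (f : Rn n → ℝ≥0∞) : Measurable (maximal f) := by
  have : LowerSemicontinuous (maximal f) := by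
    refine lowerSemicontinuous_iSup fun r => lowerSemicontinuous_iSup fun hr => ?_
    have h1 : (fun x => avg (Metric.ball x r) f) =
        (fun z => (volume (Metric.ball (0 : Rn n) r))⁻¹ * z) ∘
          fun x => (volume.withDensity f) (Metric.ball x r) := by
      ext x
      simp only [avg, Function.comp, lintegral_ball_eq_withDensity]
      rw [Measure.addHaar_ball_center volume x]
    rw [h1]
    refine Continuous.comp_lowerSemicontinuous ?_ (lowerSemicontinuous_measure_ball _ _) ?_
    · exact ENNReal.continuous_const_mul (ENNReal.inv_ne_top.2 (volume_ball_pos _ hr))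
    · exact fun a b hab => mul_le_mul_right hab _
  exact this.measurable

theorem avg_le_maximal (f : Rn n → ℝ≥0∞) (x : Rn n) {r : ℝ} (hr : 0 < r) :
    avg (Metric.ball x r) f ≤ maximal f x :=
  le_iSup₂ (f := fun (r : ℝ) (_ : 0 < r) => avg (Metric.ball x r) f) r hr

theorem maximal_const_mul_le (c : ℝ≥0∞) {f : Rn n → ℝ≥0∞} (hf : Measurable f) (x : Rn n) :
    maximal (fun y => c * f y) x ≤ c * maximal f x := by
  refine iSup₂_le fun r hr => ?_
  calc avg (Metric.ball x r) (fun y => c * f y) = c * avg (Metric.ball x r) f := by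
        unfold avg
        rw [lintegral_const_mul _ hf]
        ring
    _ ≤ _ := by gcongr; exact avg_le_maximal f x hr

theorem maximal_tsum_le {F : ℕ → Rn n → ℝ≥0∞} (hF : ∀ j, Measurable (F j)) (x : Rn n) :
    maximal (fun y => ∑' j, F j y) x ≤ ∑' j, maximal (F j) x := by
  refine iSup₂_le fun r hr => ?_
  unfold avg
  rw [lintegral_tsum fun j => (hF j).aemeasurable, ← ENNReal.tsum_mul_left]
  exact ENNReal.tsum_le_tsum fun j => avg_le_maximal (F j) x hr

theorem maximal_one_le (x : Rn n) : maximal (fun _ => 1) x ≤ 1 := by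
  refine iSup₂_le fun r hr => ?_
  simp only [avg, lintegral_const, Measure.restrict_apply_univ, one_mul]
  exact ENNReal.inv_mul_le_one _

/-! ### The Rubio de Francia iteration -/

/-- Jensen's inequality for the weights `1/2, 1/4, …`. Once the first term is peeled off, the rest
is half of a sum of the same shape, so the two-point inequality suffices. -/
theorem sum_half_pow_rpow_le {q : ℝ} (hq : 1 ≤ q) (N : ℕ) (F : ℕ → ℝ≥0∞) :
    (∑ j ∈ Finset.range N, 2⁻¹ ^ (j + 1) * F j) ^ q ≤
      ∑ j ∈ Finset.range N, 2⁻¹ ^ (j + 1) * F j ^ q := by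
  induction N generalizing F with
  | zero => simp [show 0 < q by linarith]
  | succ N ih =>
    have key : ∀ G : ℕ → ℝ≥0∞, ∑ j ∈ Finset.range (N + 1), (2⁻¹ : ℝ≥0∞) ^ (j + 1) * G j =
        2⁻¹ * (∑ j ∈ Finset.range N, 2⁻¹ ^ (j + 1) * G (j + 1)) + 2⁻¹ * G 0 := by
      intro G
      rw [Finset.sum_range_succ', Finset.mul_sum]
      simp [pow_succ', mul_assoc]
    rw [key, key]
    refine (ENNReal.rpow_arith_mean_le_arith_mean2_rpow 2⁻¹ 2⁻¹ _ _
      ENNReal.inv_two_add_inv_two hq).trans ?_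
    gcongr
    exact ih _

theorem tsum_half_pow_rpow_le {q : ℝ} (hq : 1 ≤ q) (F : ℕ → ℝ≥0∞) :
    (∑' j, 2⁻¹ ^ (j + 1) * F j) ^ q ≤ ∑' j, 2⁻¹ ^ (j + 1) * F j ^ q := by
  have hq0 : 0 < q := by linarith
  have h1 : Filter.Tendsto (fun N => (∑ j ∈ Finset.range N, 2⁻¹ ^ (j + 1) * F j) ^ q)
      Filter.atTop (nhds ((∑' j, 2⁻¹ ^ (j + 1) * F j) ^ q)) :=
    (ENNReal.continuous_rpow_const.tendsto _).comp ENNReal.summable.hasSum.tendsto_sum_nat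
  exact le_of_tendsto' h1 fun N =>
    (sum_half_pow_rpow_le hq N F).trans (ENNReal.sum_le_tsum _)

/-- If the maximal operator preserves a modular ball `{∫ F ^ q ≤ m}` up to a factor `C`, then every
function in it is dominated by an `A₁` function in it. -/
theorem exists_rubioDeFrancia {μ : Measure (Rn n)} {q : Rn n → ℝ} (hq : Measurable q)
    (hq1 : ∀ᵐ x ∂μ, 1 ≤ q x) {C : ℝ≥0} (hC : C ≠ 0) {m : ℝ≥0∞}
    (hT : ∀ F : Rn n → ℝ≥0∞, Measurable F → ∫⁻ x, F x ^ q x ∂μ ≤ m →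
      ∫⁻ x, (maximal F x / C) ^ q x ∂μ ≤ m)
    {k : Rn n → ℝ≥0∞} (hk : Measurable k) (hkm : ∫⁻ x, k x ^ q x ∂μ ≤ m) :
    ∃ v : Rn n → ℝ≥0∞, Measurable v ∧ (∀ x, k x ≤ 2 * v x) ∧ ∫⁻ x, v x ^ q x ∂μ ≤ m ∧
      ∀ x, maximal v x ≤ (2 * C : ℝ≥0) * v x := by
  -- The iterates of `G ↦ M G / C` stay in the modular ball, and so does their average with weights
  -- `2⁻¹ ^ (j + 1)`, by convexity of `t ↦ t ^ q x`. No norm is needed.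
  let F : ℕ → Rn n → ℝ≥0∞ := fun j => Nat.rec k (fun _ G x => maximal G x / C) j
  have hF0 : F 0 = k := rfl
  have hFs : ∀ j, F (j + 1) = fun x => maximal (F j) x / C := fun j => rfl
  have hFm : ∀ j, Measurable (F j) := by
    intro j
    cases j with
    | zero => exact hk
    | succ j => rw [hFs]; exact (measurable_maximal _).div_const _
  have hFi : ∀ j, ∫⁻ x, F j x ^ q x ∂μ ≤ m := by
    intro j
    induction j with
    | zero => exact hkm
    | succ j ih => rw [hFs]; exact hT _ (hFm j) ih
  have h2 : (2 : ℝ≥0∞) * 2⁻¹ = 1 := ENNReal.mul_inv_cancel (by simp) (by simp)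
  refine ⟨fun x => ∑' j, 2⁻¹ ^ (j + 1) * F j x, ?_, ?_, ?_, ?_⟩
  · exact Measurable.tsum fun j => (hFm j).const_mul _
  · intro x
    have := ENNReal.le_tsum (f := fun j => (2⁻¹ : ℝ≥0∞) ^ (j + 1) * F j x) 0
    calc k x = 2 * (2⁻¹ ^ (0 + 1) * F 0 x) := by
          rw [zero_add, pow_one, ← mul_assoc, h2, one_mul, hF0]
      _ ≤ _ := by gcongr
  · calc ∫⁻ x, (∑' j, 2⁻¹ ^ (j + 1) * F j x) ^ q x ∂μ
        ≤ ∫⁻ x, ∑' j, 2⁻¹ ^ (j + 1) * F j x ^ q x ∂μ := by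
          refine lintegral_mono_ae ?_
          filter_upwards [hq1] with x hx
          exact tsum_half_pow_rpow_le hx _
      _ = ∑' j, 2⁻¹ ^ (j + 1) * ∫⁻ x, F j x ^ q x ∂μ := by
          rw [lintegral_tsum fun j => (((hFm j).pow hq).const_mul _).aemeasurable]
          congr 1 with j
          rw [lintegral_const_mul _ ((hFm j).pow hq)]
      _ ≤ ∑' j, 2⁻¹ ^ (j + 1) * m := by
          gcongr with j
          exact hFi j
      _ = m := by
          rw [ENNReal.tsum_mul_right, ENNReal.tsum_geometric_add_one, ENNReal.one_sub_inv_two,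
            inv_inv, mul_comm (2⁻¹ : ℝ≥0∞), h2, one_mul]
  · intro x
    have hC' : (C : ℝ≥0∞) ≠ 0 := by exact_mod_cast hC
    calc maximal (fun x => ∑' j, 2⁻¹ ^ (j + 1) * F j x) x
        ≤ ∑' j, maximal (fun x => 2⁻¹ ^ (j + 1) * F j x) x :=
          maximal_tsum_le (fun j => (hFm j).const_mul _) x
      -- Since `M (F j) = C * F (j + 1)`, each term becomes `C` times the next iterate; the shift of
      -- index in the weight costs the factor `2`.
      _ ≤ ∑' j, (2 * C : ℝ≥0) * (2⁻¹ ^ (j + 1 + 1) * F (j + 1) x) := by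
          refine ENNReal.tsum_le_tsum fun j => ?_
          refine (maximal_const_mul_le _ (hFm j) x).trans_eq ?_
          rw [hFs]
          dsimp only
          conv_lhs => rw [← ENNReal.mul_div_cancel hC' ENNReal.coe_ne_top (b := maximal (F j) x)]
          rw [pow_succ (2⁻¹ : ℝ≥0∞) (j + 1), ENNReal.coe_mul, ENNReal.coe_ofNat]
          calc _ = (1 : ℝ≥0∞) * (2⁻¹ ^ (j + 1) * (C * (maximal (F j) x / C))) := by rw [one_mul]
            _ = _ := by rw [← h2]; ring
      _ = (2 * C : ℝ≥0) * ∑' j, (2⁻¹ ^ (j + 1 + 1) * F (j + 1) x) := ENNReal.tsum_mul_left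
      _ ≤ _ := by
          gcongr
          exact ENNReal.tsum_comp_le_tsum_of_injective (add_left_injective 1)
            (fun j => (2⁻¹ : ℝ≥0∞) ^ (j + 1) * F j x)

/-! ### The centered maximal operator with respect to a measure -/

noncomputable section

/-- The average of `g` over the ball of radius `2 ^ k` with respect to `μ`. -/
def dyadicAvg (μ : Measure (Rn n)) (g : Rn n → ℝ≥0∞) (k : ℤ) (x : Rn n) : ℝ≥0∞ :=
  (μ (Metric.ball x (2 ^ k)))⁻¹ * ∫⁻ y in Metric.ball x (2 ^ k), g y ∂μ

/-- The centered maximal function with respect to `μ`, over balls of dyadic radius. -/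
def centeredMaximal (μ : Measure (Rn n)) (g : Rn n → ℝ≥0∞) (x : Rn n) : ℝ≥0∞ :=
  ⨆ k : ℤ, dyadicAvg μ g k x

end

theorem measurable_centeredMaximal (μ : Measure (Rn n)) (g : Rn n → ℝ≥0∞) :
    Measurable (centeredMaximal μ g) := by
  refine Measurable.iSup fun k => Measurable.mul ?_ ?_
  · exact (lowerSemicontinuous_measure_ball μ _).measurable.inv
  · simp_rw [lintegral_ball_eq_withDensity]
    exact (lowerSemicontinuous_measure_ball _ _).measurable

theorem setLIntegral_ball_le_mul_centeredMaximal (μ : Measure (Rn n)) (g : Rn n → ℝ≥0∞)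
    (k : ℤ) (x : Rn n) (hμ : μ (Metric.ball x (2 ^ k)) ≠ ∞) :
    ∫⁻ y in Metric.ball x (2 ^ k), g y ∂μ ≤
      μ (Metric.ball x (2 ^ k)) * centeredMaximal μ g x := by
  by_cases h0 : μ (Metric.ball x (2 ^ k)) = 0
  · rw [Measure.restrict_eq_zero.2 h0, lintegral_zero_measure]
    exact zero_le
  · calc ∫⁻ y in Metric.ball x (2 ^ k), g y ∂μ = μ (Metric.ball x (2 ^ k)) * dyadicAvg μ g k x := by
          rw [dyadicAvg, ← mul_assoc, ENNReal.mul_inv_cancel h0 hμ, one_mul]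
      _ ≤ _ := by gcongr; exact le_iSup (fun k => dyadicAvg μ g k x) k

theorem mul_measure_ball_le_of_lt_dyadicAvg {μ : Measure (Rn n)} {g : Rn n → ℝ≥0∞} {k : ℤ}
    {x : Rn n} {t : ℝ≥0∞} (h : t < dyadicAvg μ g k x) :
    t * μ (Metric.ball x (2 ^ k)) ≤ ∫⁻ y in Metric.ball x (2 ^ k), g y ∂μ := by
  by_cases h0 : μ (Metric.ball x (2 ^ k)) = 0
  · simp [h0]
  by_cases h1 : μ (Metric.ball x (2 ^ k)) = ∞
  -- Here `∞⁻¹ = 0` makes the average `0`, which cannot exceed `t`.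
  · simp [dyadicAvg, h1] at h
  · calc t * μ (Metric.ball x (2 ^ k)) ≤ dyadicAvg μ g k x * μ (Metric.ball x (2 ^ k)) := by
          gcongr
      _ = ((μ (Metric.ball x (2 ^ k)))⁻¹ * μ (Metric.ball x (2 ^ k))) *
            ∫⁻ y in Metric.ball x (2 ^ k), g y ∂μ := by rw [dyadicAvg]; ring
      _ = _ := by rw [ENNReal.inv_mul_cancel h0 h1, one_mul]

/-- The weak type `(1, 1)` inequality, with a constant that does not depend on the measure. -/
theorem exists_weak_type_centeredMaximal (n : ℕ) :
    ∃ N : ℕ, ∀ (μ : Measure (Rn n)) (g : Rn n → ℝ≥0∞) (t : ℝ≥0∞),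
      t * μ {x | t < centeredMaximal μ g x} ≤ N * ∫⁻ x, g x ∂μ := by
  obtain ⟨N, τ, hτ, hN⟩ := HasBesicovitchCovering.no_satelliteConfig (α := Rn n)
  refine ⟨N, fun μ g t => ?_⟩
  -- Besicovitch's theorem needs bounded radii, so the level set is exhausted by the points with a
  -- witness of radius at most `2 ^ m`.
  let E : ℕ → Set (Rn n) := fun m => {x | ∃ k : ℤ, k ≤ m ∧ t < dyadicAvg μ g k x}
  have hE : {x | t < centeredMaximal μ g x} = ⋃ m, E m := by
    ext x
    simp only [centeredMaximal, Set.mem_ofPred_eq, lt_iSup_iff, Set.mem_iUnion, E]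
    constructor
    · rintro ⟨k, hk⟩
      exact ⟨k.toNat, k, Int.self_le_toNat k, hk⟩
    · rintro ⟨m, k, -, hk⟩
      exact ⟨k, hk⟩
  have hEmono : Monotone E := by
    rintro a b hab x ⟨k, hk, hx⟩
    exact ⟨k, hk.trans (by exact_mod_cast hab), hx⟩
  rw [hE, hEmono.directed_le.measure_iUnion, ENNReal.mul_iSup]
  refine iSup_le fun m => ?_
  have hch : ∀ x : E m, ∃ k : ℤ, k ≤ m ∧ t < dyadicAvg μ g k x := fun x => x.2
  choose κ hκm hκ using hch
  let P : Besicovitch.BallPackage (E m) (Rn n) :=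
    { c := fun x => x
      r := fun x => 2 ^ κ x
      rpos := fun x => by positivity
      r_bound := 2 ^ (m : ℤ)
      r_le := fun x => zpow_le_zpow_right₀ (by norm_num) (hκm x) }
  obtain ⟨s, hsd, hsc⟩ := Besicovitch.exist_disjoint_covering_families hτ hN P
  have hcount : ∀ i, (s i).Countable := fun i =>
    (hsd i).countable_of_nonempty_interior fun j _ =>
      (Metric.nonempty_ball.2 (P.rpos j)).mono Metric.ball_subset_interior_closedBall
  have hdisj : ∀ i, (s i).PairwiseDisjoint fun j => Metric.ball (P.c j) (P.r j) := fun i =>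
    (hsd i).mono fun j => Metric.ball_subset_closedBall
  have hsub : E m ⊆ ⋃ i : Fin N, ⋃ j ∈ s i, Metric.ball (P.c j) (P.r j) := by
    intro x hx
    exact hsc ⟨⟨x, hx⟩, rfl⟩
  calc t * μ (E m) ≤ t * ∑ i : Fin N, ∑' j : s i, μ (Metric.ball (P.c j) (P.r j)) := by
        gcongr
        refine (measure_mono hsub).trans ((measure_iUnion_fintype_le _ _).trans ?_)
        gcongr with i
        exact measure_biUnion_le _ (hcount i) _
    _ = ∑ i : Fin N, ∑' j : s i, t * μ (Metric.ball (P.c j) (P.r j)) := by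
        rw [Finset.mul_sum]
        congr 1 with i
        rw [ENNReal.tsum_mul_left]
    _ ≤ ∑ i : Fin N, ∑' j : s i, ∫⁻ y in Metric.ball (P.c j) (P.r j), g y ∂μ := by
        gcongr with i _ j
        exact mul_measure_ball_le_of_lt_dyadicAvg (hκ j)
    _ = ∑ i : Fin N, ∫⁻ y in ⋃ j ∈ s i, Metric.ball (P.c j) (P.r j), g y ∂μ := by
        congr 1 with i
        rw [lintegral_biUnion (hcount i) (fun _ _ => Metric.isOpen_ball.measurableSet) (hdisj i)]
    _ ≤ ∑ i : Fin N, ∫⁻ y, g y ∂μ := by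
        refine Finset.sum_le_sum fun i _ => ?_
        exact setLIntegral_le_lintegral _ _
    _ = N * ∫⁻ y, g y ∂μ := by simp

/-! ### Layer cake formulas for functions with values in `[0, ∞]` -/

theorem lintegral_rpow_eq_of_ae_lt_top {α : Type*} [MeasurableSpace α] {μ : Measure α}
    {y : α → ℝ≥0∞} (hy : Measurable y) (hfin : ∀ᵐ x ∂μ, y x < ∞) {p : ℝ} (hp : 0 < p) :
    ∫⁻ x, y x ^ p ∂μ = ENNReal.ofReal p *
      ∫⁻ t in Set.Ioi (0 : ℝ), μ {x | ENNReal.ofReal t < y x} * ENNReal.ofReal (t ^ (p - 1)) := by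
  have h := lintegral_rpow_eq_lintegral_meas_lt_mul μ (f := fun x => (y x).toReal)
    (Filter.Eventually.of_forall fun x => ENNReal.toReal_nonneg) hy.ennreal_toReal.aemeasurable hp
  calc ∫⁻ x, y x ^ p ∂μ = ∫⁻ x, ENNReal.ofReal ((y x).toReal ^ p) ∂μ := by
        refine lintegral_congr_ae ?_
        filter_upwards [hfin] with x hx
        rw [← ENNReal.ofReal_rpow_of_nonneg ENNReal.toReal_nonneg hp.le,
          ENNReal.ofReal_toReal hx.ne]
    _ = _ := h
    _ = _ := by
        congr 1
        refine setLIntegral_congr_fun measurableSet_Ioi fun t ht => ?_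
        congr 1
        refine measure_congr ?_
        filter_upwards [hfin] with x hx
        refine propext ?_
        exact (ENNReal.ofReal_lt_iff_lt_toReal (le_of_lt ht) hx.ne).symm

/-- Truncation at the integers makes the function finite, and monotone convergence removes it. An
upper bound is all that is needed for the maximal function, whose finiteness is not known in
advance. -/
theorem lintegral_rpow_le_layercake {α : Type*} [MeasurableSpace α] {μ : Measure α}
    {y : α → ℝ≥0∞} (hy : Measurable y) {p : ℝ} (hp : 0 < p) :
    ∫⁻ x, y x ^ p ∂μ ≤ ENNReal.ofReal p *
      ∫⁻ t in Set.Ioi (0 : ℝ), μ {x | ENNReal.ofReal t < y x} * ENNReal.ofReal (t ^ (p - 1)) := by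
  have hsup : ∀ x, y x ^ p = ⨆ j : ℕ, (y x ⊓ j) ^ p := by
    intro x
    have h1 : y x = ⨆ j : ℕ, y x ⊓ (j : ℝ≥0∞) := by
      rw [← inf_iSup_eq, ENNReal.iSup_natCast, inf_top_eq]
    conv_lhs => rw [h1]
    exact (ENNReal.orderIsoRpow p hp).map_iSup _
  simp_rw [hsup]
  rw [lintegral_iSup (fun j => (hy.inf_const _).pow_const _)
    (fun a b hab x => by dsimp only; gcongr)]
  refine iSup_le fun j => ?_
  rw [lintegral_rpow_eq_of_ae_lt_top (hy.inf_const _)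
    (Filter.Eventually.of_forall fun x => inf_le_right.trans_lt (ENNReal.natCast_lt_top j)) hp]
  gcongr with t x
  exact inf_le_left

/-- The strong type `(p, p)` inequality, with a constant that does not depend on the measure. -/
theorem exists_strong_type_centeredMaximal (n : ℕ) {p : ℝ} (hp : 1 < p) :
    ∃ C : ℝ≥0, ∀ (μ : Measure (Rn n)) (g : Rn n → ℝ≥0∞), Measurable g →
      ∫⁻ x, centeredMaximal μ g x ^ p ∂μ ≤ C * ∫⁻ x, g x ^ p ∂μ := by
  obtain ⟨N, hN⟩ := exists_weak_type_centeredMaximal n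
  have hp0 : 0 < p := by linarith
  have hp1 : 0 < p - 1 := by linarith
  -- The added `1` keeps `C` nonzero, so the bound is trivial when `∫ g ^ p` is infinite.
  let C : ℝ≥0 := (2 ^ p * p * N * (p - 1)⁻¹).toNNReal + 1
  refine ⟨C, fun μ g hg => ?_⟩
  by_cases htop : ∫⁻ x, g x ^ p ∂μ = ∞
  · rw [htop, ENNReal.mul_top (by simp [C])]
    exact le_top
  have hgfin : ∀ᵐ x ∂μ, g x < ∞ := by
    filter_upwards [ae_lt_top (hg.pow_const p) htop] with x hx
    exact (ENNReal.rpow_lt_top_iff_of_pos hp0).1 hx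
  -- Marcinkiewicz splitting: the part of `g` below height `t` adds at most `t` to the maximal
  -- function, whence the division by `2`. The weak bound leaves the mass of `{g > t}` for `g dμ`,
  -- which the layer cake formula for that measure with exponent `p - 1` sums up.
  have hweak : ∀ t : ℝ, 0 < t → μ {x | ENNReal.ofReal t < centeredMaximal μ g x / 2} *
      ENNReal.ofReal (t ^ (p - 1)) ≤
      N * ((μ.withDensity g) {x | ENNReal.ofReal t < g x} * ENNReal.ofReal (t ^ (p - 1 - 1))) := by
    intro t ht
    have hms : MeasurableSet {x | ENNReal.ofReal t < g x} := measurableSet_lt measurable_const hg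
    let G : Rn n → ℝ≥0∞ := Set.indicator {x | ENNReal.ofReal t < g x} g
    have hgG : ∀ x, g x ≤ G x + ENNReal.ofReal t := by
      intro x
      by_cases hx : ENNReal.ofReal t < g x
      · simp [G, hx]
      · have h0 : G x = 0 := by simp only [G, Set.indicator_apply_eq_zero]; exact fun h => absurd h hx
        rw [h0, zero_add]
        exact not_lt.1 hx
    have hM : ∀ x, centeredMaximal μ g x ≤ centeredMaximal μ G x + ENNReal.ofReal t := by
      intro x
      refine iSup_le fun k => ?_
      calc dyadicAvg μ g k x ≤ (μ (Metric.ball x (2 ^ k)))⁻¹ *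
            ∫⁻ y in Metric.ball x (2 ^ k), (G y + ENNReal.ofReal t) ∂μ := by
            unfold dyadicAvg
            gcongr with y
            exact hgG y
        _ = dyadicAvg μ G k x + ENNReal.ofReal t *
              ((μ (Metric.ball x (2 ^ k)))⁻¹ * μ (Metric.ball x (2 ^ k))) := by
            rw [lintegral_add_right _ measurable_const, lintegral_const,
              Measure.restrict_apply_univ, dyadicAvg]
            ring
        _ ≤ centeredMaximal μ G x + ENNReal.ofReal t * 1 := by
            gcongr
            · exact le_iSup (fun k => dyadicAvg μ G k x) k
            · exact ENNReal.inv_mul_le_one _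
        _ = _ := by rw [mul_one]
    have hsub : {x | ENNReal.ofReal t < centeredMaximal μ g x / 2} ⊆
        {x | ENNReal.ofReal t < centeredMaximal μ G x} := by
      intro x hx
      by_contra hcon
      have hcon' : centeredMaximal μ G x ≤ ENNReal.ofReal t := not_lt.1 hcon
      have h2 : centeredMaximal μ g x / 2 ≤ ENNReal.ofReal t := by
        refine ENNReal.div_le_of_le_mul ((hM x).trans ?_)
        rw [mul_two]
        gcongr
      exact absurd hx (not_lt.2 h2)
    have hpow : ENNReal.ofReal (t ^ (p - 1)) =
        ENNReal.ofReal t * ENNReal.ofReal (t ^ (p - 1 - 1)) := by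
      rw [← ENNReal.ofReal_mul ht.le, Real.rpow_sub_one ht.ne' (p - 1)]
      congr 1
      field_simp
    calc μ {x | ENNReal.ofReal t < centeredMaximal μ g x / 2} * ENNReal.ofReal (t ^ (p - 1))
        ≤ μ {x | ENNReal.ofReal t < centeredMaximal μ G x} * ENNReal.ofReal (t ^ (p - 1)) := by
          gcongr
      _ = (ENNReal.ofReal t * μ {x | ENNReal.ofReal t < centeredMaximal μ G x}) *
            ENNReal.ofReal (t ^ (p - 1 - 1)) := by rw [hpow]; ring
      _ ≤ (N * ∫⁻ x, G x ∂μ) * ENNReal.ofReal (t ^ (p - 1 - 1)) := by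
          gcongr ?_ * _
          exact hN μ G _
      _ = _ := by
          rw [lintegral_indicator hms, withDensity_apply _ hms]
          ring
  have hνfin : ∀ᵐ x ∂(μ.withDensity g), g x < ∞ :=
    (withDensity_absolutelyContinuous μ g).ae_le hgfin
  have hcake := lintegral_rpow_eq_of_ae_lt_top hg hνfin hp1
  have hgg : ∫⁻ x, g x ^ (p - 1) ∂(μ.withDensity g) = ∫⁻ x, g x ^ p ∂μ := by
    rw [lintegral_withDensity_eq_lintegral_mul _ hg (hg.pow_const _)]
    refine lintegral_congr_ae ?_
    filter_upwards [hgfin] with x hx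
    rw [Pi.mul_apply]
    conv_lhs => rw [← ENNReal.rpow_one (g x), ← ENNReal.rpow_mul, one_mul]
    rw [← ENNReal.rpow_add_of_nonneg _ _ zero_le_one hp1.le]
    congr 1
    ring
  rw [hgg] at hcake
  set I := ∫⁻ t in Set.Ioi (0 : ℝ), (μ.withDensity g) {x | ENNReal.ofReal t < g x} *
    ENNReal.ofReal (t ^ (p - 1 - 1)) with hI
  have hI' : I = ENNReal.ofReal (p - 1)⁻¹ * ∫⁻ x, g x ^ p ∂μ := by
    rw [hcake, ← mul_assoc, ← ENNReal.ofReal_mul (by positivity), inv_mul_cancel₀ hp1.ne',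
      ENNReal.ofReal_one, one_mul]
  calc ∫⁻ x, centeredMaximal μ g x ^ p ∂μ
      = ∫⁻ x, 2 ^ p * (centeredMaximal μ g x / 2) ^ p ∂μ := by
        congr 1 with x
        rw [← ENNReal.mul_rpow_of_nonneg _ _ hp0.le, ENNReal.mul_div_cancel (by simp) (by simp)]
    _ = 2 ^ p * ∫⁻ x, (centeredMaximal μ g x / 2) ^ p ∂μ :=
        lintegral_const_mul _ (((measurable_centeredMaximal μ g).div_const _).pow_const _)
    _ ≤ 2 ^ p * (ENNReal.ofReal p * ∫⁻ t in Set.Ioi (0 : ℝ),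
          μ {x | ENNReal.ofReal t < centeredMaximal μ g x / 2} *
            ENNReal.ofReal (t ^ (p - 1))) := by
        gcongr
        exact lintegral_rpow_le_layercake ((measurable_centeredMaximal μ g).div_const _) hp0
    _ ≤ 2 ^ p * (ENNReal.ofReal p * ∫⁻ t in Set.Ioi (0 : ℝ),
          N * ((μ.withDensity g) {x | ENNReal.ofReal t < g x} *
            ENNReal.ofReal (t ^ (p - 1 - 1)))) := by
        gcongr 2 ^ p * (ENNReal.ofReal p * ?_)
        exact setLIntegral_mono' measurableSet_Ioi fun t ht => hweak t ht
    _ = 2 ^ p * (ENNReal.ofReal p * (N * I)) := by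
        rw [lintegral_const_mul' _ _ (ENNReal.natCast_ne_top N)]
    _ = ENNReal.ofReal (2 ^ p * p * N * (p - 1)⁻¹) * ∫⁻ x, g x ^ p ∂μ := by
        rw [hI', ENNReal.ofReal_mul (by positivity), ENNReal.ofReal_mul (by positivity),
          ENNReal.ofReal_mul (by positivity), ENNReal.ofReal_natCast,
          ← ENNReal.ofReal_rpow_of_pos (by norm_num), ENNReal.ofReal_ofNat]
        ring
    _ ≤ C * ∫⁻ x, g x ^ p ∂μ := by
        gcongr
        simp only [C, ENNReal.coe_add]
        exact le_self_add

/-! ### Positive finite elements of `[0, ∞]` as exponentials -/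

noncomputable section

/-- The exponential as a map into `[0, ∞]`; its range consists of the positive finite elements. -/
def eexp (s : ℝ) : ℝ≥0∞ := ENNReal.ofReal (Real.exp s)

end

/-- In these coordinates an identity between products of powers, negative ones included, becomes a
linear identity between exponents, within reach of `field_simp` and `ring`. -/
theorem exists_eq_eexp {a : ℝ≥0∞} (h0 : a ≠ 0) (h1 : a ≠ ∞) : ∃ s, a = eexp s :=
  ⟨Real.log a.toReal, by
    rw [eexp, Real.exp_log (ENNReal.toReal_pos h0 h1), ENNReal.ofReal_toReal h1]⟩

theorem eexp_ne_zero (s : ℝ) : eexp s ≠ 0 := by simp [eexp, Real.exp_pos]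

theorem eexp_ne_top (s : ℝ) : eexp s ≠ ∞ := ENNReal.ofReal_ne_top

theorem eexp_rpow (s t : ℝ) : eexp s ^ t = eexp (s * t) := by
  rw [eexp, eexp, ENNReal.ofReal_rpow_of_pos (Real.exp_pos s), Real.exp_mul]

theorem eexp_mul (s t : ℝ) : eexp s * eexp t = eexp (s + t) := by
  rw [eexp, eexp, eexp, ← ENNReal.ofReal_mul (Real.exp_pos s).le, Real.exp_add]

theorem eexp_inv (s : ℝ) : (eexp s)⁻¹ = eexp (-s) := by
  rw [eexp, eexp, Real.exp_neg, ENNReal.ofReal_inv_of_pos (Real.exp_pos s)]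

theorem eexp_zero : eexp 0 = 1 := by simp [eexp]

theorem rpow_anti_of_nonpos {a b : ℝ≥0∞} {t : ℝ} (ht : t ≤ 0) (hab : a ≤ b) :
    b ^ t ≤ a ^ t := by
  rw [← neg_neg t, ENNReal.rpow_neg, ENNReal.rpow_neg a]
  exact ENNReal.inv_le_inv.2 (ENNReal.rpow_le_rpow hab (by linarith))

theorem conjExponent_eq (p : ℝ) : p.conjExponent = p / (p - 1) := rfl

theorem one_sub_conjExponent {p : ℝ} (hp : 1 < p) : 1 - p.conjExponent = -(1 / (p - 1)) := by
  have : p - 1 ≠ 0 := by linarith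
  rw [conjExponent_eq]
  field_simp
  ring

/-! ### `A₁` weights -/

/-- `u` is positive, finite almost everywhere, and `M u ≤ K u`. -/
structure IsA1 (K : ℝ≥0) (u : Rn n → ℝ≥0∞) : Prop where
  measurable : Measurable u
  ne_zero : ∀ x, u x ≠ 0
  ae_ne_top : ∀ᵐ x, u x ≠ ∞
  maximal_le : ∀ x, maximal u x ≤ K * u x

theorem isA1_one : IsA1 1 (fun _ : Rn n => 1) where
  measurable := measurable_const
  ne_zero := by simp
  ae_ne_top := by simp
  maximal_le x := by simpa using maximal_one_le x

/-- A zero of `u` at `x` forces `M u x = 0`, so `u` vanishes almost everywhere on all balls about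
`x`, and these exhaust the space. -/
theorem ne_zero_of_maximal_le {u : Rn n → ℝ≥0∞} (hu : Measurable u) {K : ℝ≥0}
    (h : ∀ x, maximal u x ≤ K * u x) (h0 : ¬ u =ᵐ[volume] 0) (x : Rn n) : u x ≠ 0 := by
  intro hx
  apply h0
  have hM : maximal u x = 0 := by simpa [hx] using h x
  have hball : ∀ m : ℕ, ∀ᵐ y ∂(volume.restrict (Metric.ball x (m + 1))), u y = 0 := by
    intro m
    have h1 : avg (Metric.ball x (m + 1)) u = 0 :=
      le_antisymm ((avg_le_maximal u x (by positivity)).trans_eq hM) zero_le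
    rw [avg, mul_eq_zero, ENNReal.inv_eq_zero] at h1
    exact (lintegral_eq_zero_iff hu).1 (h1.resolve_left (volume_ball_ne_top _ _))
  have hU : (⋃ m : ℕ, Metric.ball x ((m : ℝ) + 1)) = Set.univ := by
    refine Set.eq_univ_of_forall fun y => Set.mem_iUnion.2 ?_
    obtain ⟨m, hm⟩ := exists_nat_gt (dist y x)
    exact ⟨m, by rw [Metric.mem_ball]; linarith⟩
  have := (ae_restrict_iUnion_iff _ _).2 hball
  rwa [hU, Measure.restrict_univ] at this

/-! ### Sets comparable to balls: one treatment of the balls of `M` and the cubes of the `A_p`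
constant -/

/-- `E` is comparable to the ball of some radius around each of its points. -/
structure IsFat (c : ℝ≥0) (E : Set (Rn n)) : Prop where
  measurableSet : MeasurableSet E
  exists_radius : ∃ R : ℝ, 0 < R ∧ (∀ x ∈ E, E ⊆ Metric.ball x R) ∧
    volume (Metric.ball (0 : Rn n) R) ≤ c * volume E

theorem IsFat.volume_ne_zero {c : ℝ≥0} {E : Set (Rn n)} (hE : IsFat c E) : volume E ≠ 0 := by
  obtain ⟨R, hR, -, h⟩ := hE.exists_radius
  intro h0
  rw [h0, mul_zero] at h
  exact volume_ball_pos _ hR (le_antisymm h zero_le)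

theorem IsFat.volume_ne_top {c : ℝ≥0} {E : Set (Rn n)} (hE : IsFat c E) : volume E ≠ ∞ := by
  obtain ⟨R, hR, hsub, -⟩ := hE.exists_radius
  obtain ⟨x, hx⟩ := nonempty_of_measure_ne_zero hE.volume_ne_zero
  exact ((measure_mono (hsub x hx)).trans_lt measure_ball_lt_top).ne

theorem IsFat.avg_le {c : ℝ≥0} {E : Set (Rn n)} (hE : IsFat c E) (u : Rn n → ℝ≥0∞) {x : Rn n}
    (hx : x ∈ E) : avg E u ≤ c * maximal u x := by
  obtain ⟨R, hR, hsub, hv⟩ := hE.exists_radius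
  rw [← Measure.addHaar_ball_center volume x] at hv
  have h1 : (volume E)⁻¹ ≤ c * (volume (Metric.ball x R))⁻¹ := by
    rw [← div_eq_mul_inv, ENNReal.le_div_iff_mul_le (Or.inl (volume_ball_pos _ hR))
      (Or.inl (volume_ball_ne_top _ _))]
    calc (volume E)⁻¹ * volume (Metric.ball x R) ≤ (volume E)⁻¹ * (c * volume E) := by gcongr
      _ = c * ((volume E)⁻¹ * volume E) := by ring
      _ ≤ c * 1 := by gcongr; exact ENNReal.inv_mul_le_one _
      _ = c := mul_one _
  calc avg E u ≤ (c * (volume (Metric.ball x R))⁻¹) * ∫⁻ y in Metric.ball x R, u y := by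
        unfold avg
        gcongr
        exact hsub x hx
    _ = c * avg (Metric.ball x R) u := by unfold avg; ring
    _ ≤ _ := by gcongr; exact avg_le_maximal u x hR

theorem isFat_ball (x : Rn n) {r : ℝ} (hr : 0 < r) : IsFat (2 ^ n) (Metric.ball x r) where
  measurableSet := Metric.isOpen_ball.measurableSet
  exists_radius := by
    refine ⟨2 * r, by positivity, fun y hy => ?_, ?_⟩
    · refine Metric.ball_subset_ball' ?_
      rw [Metric.mem_ball, dist_comm] at hy
      linarith
    · rw [volume_ball_mul 0 x two_pos, ENNReal.ofReal_pow (by norm_num)]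
      simp

theorem isFat_cube (a : Rn n) {l : ℝ} (hl : 0 < l) :
    IsFat ((2 * (n + 1)) ^ n) (cube a l) where
  measurableSet := by
    have : cube a l = ⋂ i, (fun x : Rn n => x i) ⁻¹' Set.Icc (a i) (a i + l) := by
      ext x; simp [cube]
    rw [this]
    refine MeasurableSet.iInter fun i => measurableSet_Icc.preimage ?_
    exact (EuclideanSpace.proj (𝕜 := ℝ) i).continuous.measurable
  exists_radius := by
    -- This radius `(n + 1) * l` exceeds the diameter `√n * l`; it is written as a multiple of `l /
    -- 2`, the radius of the inscribed ball.
    refine ⟨(2 * (n + 1)) * (l / 2), by positivity, fun x hx y hy => ?_, ?_⟩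
    · rw [Metric.mem_ball, EuclideanSpace.dist_eq, Real.sqrt_lt' (by positivity)]
      calc ∑ i, dist (y i) (x i) ^ 2 ≤ ∑ i : Fin n, l ^ 2 := by
            gcongr with i
            rw [Real.dist_eq, abs_le]
            have h1 := hx i
            have h2 := hy i
            rw [Set.mem_Icc] at h1 h2
            constructor <;> linarith
        _ = n * l ^ 2 := by simp
        _ < (2 * (n + 1) * (l / 2)) ^ 2 := by
            have : (0 : ℝ) ≤ n := n.cast_nonneg
            nlinarith [mul_nonneg this (sq_nonneg l), mul_nonneg (mul_nonneg this this) (sq_nonneg l),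
              pow_pos hl 2]
    · let c : Rn n := WithLp.toLp 2 fun i => a i + l / 2
      have hsub : Metric.ball c (l / 2) ⊆ cube a l := by
        intro y hy i
        have h1 : ‖(y - c) i‖ ≤ ‖y - c‖ := PiLp.norm_apply_le _ i
        rw [Metric.mem_ball, dist_eq_norm] at hy
        have h2 := abs_lt.1 (h1.trans_lt hy)
        have h3 : (y - c) i = y i - (a i + l / 2) := rfl
        rw [h3] at h2
        exact ⟨by linarith [h2.1], by linarith [h2.2]⟩
      rw [volume_ball_mul 0 c (by positivity)]
      have h4 : ENNReal.ofReal ((2 * ((n : ℝ) + 1)) ^ n) = (((2 * (n + 1)) ^ n : ℝ≥0) : ℝ≥0∞) := by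
        rw [ENNReal.ofReal]
        congr 1
        ext
        rw [Real.coe_toNNReal _ (by positivity)]
        push_cast
        rfl
      rw [h4]
      gcongr

theorem IsFat.avg_ne_zero {c : ℝ≥0} {E : Set (Rn n)} (hE : IsFat c E) {u : Rn n → ℝ≥0∞}
    (hu : Measurable u) (h : ∀ᵐ x, u x ≠ 0) : avg E u ≠ 0 := by
  rw [avg, mul_ne_zero_iff]
  refine ⟨ENNReal.inv_ne_zero.2 hE.volume_ne_top, fun h0 => ?_⟩
  rw [lintegral_eq_zero_iff hu] at h0
  have : ∀ᵐ x ∂(volume.restrict E), False := by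
    filter_upwards [h0, ae_restrict_of_ae h] with x h1 h2
    exact h2 h1
  rw [ae_iff] at this
  simp only [not_false_eq_true, Set.ofPred_true, Measure.restrict_apply_univ] at this
  exact hE.volume_ne_zero this

theorem IsFat.avg_ne_top {c K : ℝ≥0} {E : Set (Rn n)} (hE : IsFat c E) {u : Rn n → ℝ≥0∞}
    (hu : IsA1 K u) : avg E u ≠ ∞ := by
  obtain ⟨x, hx, hux⟩ : ∃ x ∈ E, u x ≠ ∞ := by
    by_contra hcon
    push Not at hcon
    exact hE.volume_ne_zero (measure_mono_null (fun x hx => not_not.2 (hcon x hx))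
      (ae_iff.1 hu.ae_ne_top))
  refine ((hE.avg_le u hx).trans_lt ?_).ne
  exact ENNReal.mul_lt_top ENNReal.coe_lt_top ((hu.maximal_le x).trans_lt
    (ENNReal.mul_lt_top ENNReal.coe_lt_top hux.lt_top))

theorem IsFat.avg_const_mul_ae {c : ℝ≥0} {E : Set (Rn n)} (hE : IsFat c E) {f u : Rn n → ℝ≥0∞}
    {a : ℝ≥0∞} (hu : Measurable u) (h : ∀ᵐ x, x ∈ E → f x ≤ a * u x) :
    avg E f ≤ a * avg E u := by
  calc avg E f ≤ (volume E)⁻¹ * ∫⁻ x in E, a * u x := by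
        unfold avg
        refine mul_le_mul_right ?_ _
        exact lintegral_mono_ae ((ae_restrict_iff' hE.measurableSet).2 h)
    _ = _ := by
        rw [lintegral_const_mul _ hu, avg]
        ring

/-- The easy half of the factorization theorem: `u v ^ (1 - p)` is an `A_p` weight if `u` and `v`
are `A₁` weights. -/
theorem IsFat.ap_le {c K L : ℝ≥0} {E : Set (Rn n)} (hE : IsFat c E) {u v : Rn n → ℝ≥0∞}
    (hu : IsA1 K u) (hv : IsA1 L v) {p : ℝ} (hp : 1 < p) :
    avg E (fun x => u x * v x ^ (1 - p)) ≠ ∞ ∧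
    avg E (fun x => u x * v x ^ (1 - p)) *
      avg E (fun x => (u x * v x ^ (1 - p)) ^ (1 - p.conjExponent)) ^ (p - 1) ≤
      (c * K * (c * L) ^ (p - 1) : ℝ≥0) := by
  have hp1 : 0 < p - 1 := by linarith
  have hAu : ∀ x ∈ E, avg E u ≤ (c * K : ℝ≥0) * u x := by
    intro x hx
    refine (hE.avg_le u hx).trans ?_
    rw [ENNReal.coe_mul, mul_assoc]
    gcongr
    exact hu.maximal_le x
  have hAv : ∀ x ∈ E, avg E v ≤ (c * L : ℝ≥0) * v x := by
    intro x hx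
    refine (hE.avg_le v hx).trans ?_
    rw [ENNReal.coe_mul, mul_assoc]
    gcongr
    exact hv.maximal_le x
  obtain ⟨z, hz⟩ := nonempty_of_measure_ne_zero hE.volume_ne_zero
  have hu0 := hE.avg_ne_zero hu.measurable (Filter.Eventually.of_forall hu.ne_zero)
  have hv0 := hE.avg_ne_zero hv.measurable (Filter.Eventually.of_forall hv.ne_zero)
  have hα0 : ((c * K : ℝ≥0) : ℝ≥0∞) ≠ 0 := by
    intro h
    have := hAu z hz
    rw [h, zero_mul] at this
    exact hu0 (le_antisymm this zero_le)
  have hβ0 : ((c * L : ℝ≥0) : ℝ≥0∞) ≠ 0 := by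
    intro h
    have := hAv z hz
    rw [h, zero_mul] at this
    exact hv0 (le_antisymm this zero_le)
  obtain ⟨α, hα⟩ := exists_eq_eexp hα0 ENNReal.coe_ne_top
  obtain ⟨β, hβ⟩ := exists_eq_eexp hβ0 ENNReal.coe_ne_top
  obtain ⟨a, ha⟩ := exists_eq_eexp hu0 (hE.avg_ne_top hu)
  obtain ⟨b, hb⟩ := exists_eq_eexp hv0 (hE.avg_ne_top hv)
  -- The `A₁` condition bounds `u` and `v` below on `E` by multiples of their averages. Negative
  -- powers turn this into upper bounds, and the two averages cancel in the `A_p` product.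
  have hua : ∀ x ∈ E, eexp (a - α) ≤ u x := by
    intro x hx
    have := hAu x hx
    rw [ha, hα] at this
    calc eexp (a - α) = eexp (-α) * eexp a := by rw [eexp_mul]; ring_nf
      _ ≤ eexp (-α) * (eexp α * u x) := by gcongr
      _ = u x := by rw [← mul_assoc, eexp_mul, neg_add_cancel, eexp_zero, one_mul]
  have hvb : ∀ x ∈ E, eexp (b - β) ≤ v x := by
    intro x hx
    have := hAv x hx
    rw [hb, hβ] at this
    calc eexp (b - β) = eexp (-β) * eexp b := by rw [eexp_mul]; ring_nf
      _ ≤ eexp (-β) * (eexp β * v x) := by gcongr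
      _ = v x := by rw [← mul_assoc, eexp_mul, neg_add_cancel, eexp_zero, one_mul]
  have h1 : avg E (fun x => u x * v x ^ (1 - p)) ≤ eexp ((b - β) * (1 - p)) * eexp a := by
    rw [← ha]
    refine hE.avg_const_mul_ae hu.measurable (Filter.Eventually.of_forall fun x hx => ?_)
    rw [mul_comm, ← eexp_rpow]
    gcongr ?_ * _
    exact rpow_anti_of_nonpos (by linarith) (hvb x hx)
  have h2 : avg E (fun x => (u x * v x ^ (1 - p)) ^ (1 - p.conjExponent)) ≤
      eexp ((a - α) * (-(1 / (p - 1)))) * eexp b := by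
    rw [← hb]
    refine hE.avg_const_mul_ae hv.measurable ?_
    filter_upwards [hu.ae_ne_top, hv.ae_ne_top] with x hxu hxv hx
    have hle := hua x hx
    obtain ⟨s, hs⟩ := exists_eq_eexp (hu.ne_zero x) hxu
    obtain ⟨t, ht⟩ := exists_eq_eexp (hv.ne_zero x) hxv
    calc (u x * v x ^ (1 - p)) ^ (1 - p.conjExponent) = u x ^ (-(1 / (p - 1))) * v x := by
          rw [hs, ht, one_sub_conjExponent hp]
          simp only [eexp_rpow, eexp_mul]
          congr 1
          field_simp
          ring
      _ ≤ _ := by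
          rw [← eexp_rpow]
          gcongr ?_ * _
          exact rpow_anti_of_nonpos
            (by have := one_div_pos.2 hp1; linarith) hle
  refine ⟨(h1.trans_lt (by rw [eexp_mul]; exact (eexp_ne_top _).lt_top)).ne, ?_⟩
  calc _ ≤ (eexp ((b - β) * (1 - p)) * eexp a) *
        (eexp ((a - α) * (-(1 / (p - 1)))) * eexp b) ^ (p - 1) := by
        gcongr
    _ = eexp α * eexp β ^ (p - 1) := by
        simp only [eexp_rpow, eexp_mul]
        congr 1
        field_simp
        ring
    _ = _ := by
        rw [ENNReal.coe_mul, hα, ENNReal.coe_rpow_of_nonneg _ hp1.le, hβ]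

/-! ### Muckenhoupt's theorem -/

theorem maximal_le_mul_centeredMaximal (f : Rn n → ℝ≥0∞) (x : Rn n) :
    maximal f x ≤ 2 ^ n * centeredMaximal volume f x := by
  refine iSup₂_le fun r hr => ?_
  obtain ⟨k, hk1, hk2⟩ := exists_mem_Ico_zpow (y := (2 : ℝ)) hr (by norm_num)
  have hvol : volume (Metric.ball x ((2 : ℝ) ^ (k + 1))) ≤ 2 ^ n * volume (Metric.ball x r) := by
    calc volume (Metric.ball x ((2 : ℝ) ^ (k + 1))) ≤ volume (Metric.ball x (2 * r)) := by
          refine measure_mono (Metric.ball_subset_ball ?_)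
          rw [zpow_add_one₀ (by norm_num)]
          linarith
      _ = _ := by
          rw [volume_ball_mul x x two_pos, ENNReal.ofReal_pow (by norm_num), ENNReal.ofReal_ofNat]
  have hpos : (0 : ℝ) < 2 ^ (k + 1) := by positivity
  have h1 : (volume (Metric.ball x r))⁻¹ ≤
      2 ^ n * (volume (Metric.ball x ((2 : ℝ) ^ (k + 1))))⁻¹ := by
    rw [← div_eq_mul_inv, ENNReal.le_div_iff_mul_le (Or.inl (volume_ball_pos _ hpos))
      (Or.inl (volume_ball_ne_top _ _))]
    calc _ ≤ (volume (Metric.ball x r))⁻¹ * (2 ^ n * volume (Metric.ball x r)) := by gcongr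
      _ = 2 ^ n * ((volume (Metric.ball x r))⁻¹ * volume (Metric.ball x r)) := by ring
      _ ≤ 2 ^ n * 1 := by gcongr; exact ENNReal.inv_mul_le_one _
      _ = _ := mul_one _
  calc avg (Metric.ball x r) f ≤ (2 ^ n * (volume (Metric.ball x ((2 : ℝ) ^ (k + 1))))⁻¹) *
        ∫⁻ y in Metric.ball x (2 ^ (k + 1)), f y := by
        unfold avg
        gcongr
    _ = 2 ^ n * dyadicAvg volume f (k + 1) x := by unfold dyadicAvg; ring
    _ ≤ _ := by gcongr; exact le_iSup (fun k => dyadicAvg volume f k x) (k + 1)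

/-- The pointwise inequality behind Lerner's proof of Muckenhoupt's theorem: with `σ` the dual
weight of `w`, the maximal function is controlled by the composition of two maximal operators with
respect to the measures `σ` and `w`. -/
theorem dyadicAvg_rpow_le {p : ℝ} (hp : 1 < p) {K : ℝ≥0} {w σ f : Rn n → ℝ≥0∞}
    (hw : Measurable w) (hσ : Measurable σ) (hf : Measurable f)
    (hw0 : ∀ᵐ x, w x ≠ 0) (hw1 : ∀ᵐ x, w x ≠ ∞) (hσ0 : ∀ᵐ x, σ x ≠ 0) (hσ1 : ∀ᵐ x, σ x ≠ ∞)
    (hK : ∀ (x : Rn n) (r : ℝ), 0 < r →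
      avg (Metric.ball x r) w * avg (Metric.ball x r) σ ^ (p - 1) ≤ K)
    (k : ℤ) (x : Rn n) :
    dyadicAvg volume f k x ^ (p - 1) ≤ K * ENNReal.ofReal (4 ^ n) ^ p *
      centeredMaximal (volume.withDensity w) (fun y =>
        centeredMaximal (volume.withDensity σ) (fun z => f z / σ z) y ^ (p - 1) * (w y)⁻¹) x := by
  have hp1 : 0 < p - 1 := by linarith
  set μw := volume.withDensity w with hμw
  set μσ := volume.withDensity σ with hμσ
  set Mσ := centeredMaximal μσ (fun z => f z / σ z) with hMσ
  set Φ : Rn n → ℝ≥0∞ := fun y => Mσ y ^ (p - 1) * (w y)⁻¹ with hΦ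
  have hr : (0 : ℝ) < 2 ^ k := by positivity
  have hr4 : (0 : ℝ) < 4 * 2 ^ k := by positivity
  set B := Metric.ball x ((2 : ℝ) ^ k) with hB
  set D := Metric.ball x (4 * (2 : ℝ) ^ k) with hD
  have hBD : B ⊆ D := Metric.ball_subset_ball (by linarith)
  have hfat : IsFat (2 ^ n) D := isFat_ball x hr4
  have hVB0 : volume B ≠ 0 := volume_ball_pos x hr
  have hVB1 : volume B ≠ ∞ := volume_ball_ne_top x _
  have hVD0 : volume D ≠ 0 := volume_ball_pos x hr4
  have hVD1 : volume D ≠ ∞ := volume_ball_ne_top x _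
  have hBm : MeasurableSet B := Metric.isOpen_ball.measurableSet
  have hDm : MeasurableSet D := Metric.isOpen_ball.measurableSet
  have havw : avg D w = (volume D)⁻¹ * μw D := by rw [avg, hμw, withDensity_apply _ hDm]
  have havσ : avg D σ = (volume D)⁻¹ * μσ D := by rw [avg, hμσ, withDensity_apply _ hDm]
  have hK' := hK x _ hr4
  have hw2 : avg D w ≠ ∞ := by
    intro h
    rw [← hD, h, ENNReal.top_mul] at hK'
    · exact ENNReal.coe_ne_top (top_le_iff.1 hK')
    · rw [Ne, ENNReal.rpow_eq_zero_iff_of_pos hp1]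
      exact hfat.avg_ne_zero hσ hσ0
  have hσ2 : avg D σ ≠ ∞ := by
    intro h
    rw [← hD, h, ENNReal.top_rpow_of_pos hp1, ENNReal.mul_top (hfat.avg_ne_zero hw hw0)] at hK'
    exact ENNReal.coe_ne_top (top_le_iff.1 hK')
  have hwD : μw D = volume D * avg D w := by
    rw [havw, ← mul_assoc, ENNReal.mul_inv_cancel hVD0 hVD1, one_mul]
  have hσD : μσ D = volume D * avg D σ := by
    rw [havσ, ← mul_assoc, ENNReal.mul_inv_cancel hVD0 hVD1, one_mul]
  have hμw1 : μw D ≠ ∞ := by rw [hwD]; exact ENNReal.mul_ne_top hVD1 hw2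
  have hμσ1 : μσ D ≠ ∞ := by rw [hσD]; exact ENNReal.mul_ne_top hVD1 hσ2
  -- The ball of radius `2 * 2 ^ k` about any `y ∈ B` lies between `B` and `D`, so one integral is
  -- controlled by `Mσ` at every point of `B`.
  have hstep1 : ∀ y ∈ B, ∫⁻ z in B, f z ≤ μσ D * Mσ y := by
    intro y hy
    have hy' : dist y x < 2 ^ k := hy
    have hsub1 : B ⊆ Metric.ball y ((2 : ℝ) ^ (k + 1)) := by
      refine Metric.ball_subset_ball' ?_
      rw [zpow_add_one₀ (by norm_num), dist_comm]
      linarith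
    have hsub2 : Metric.ball y ((2 : ℝ) ^ (k + 1)) ⊆ D := by
      refine Metric.ball_subset_ball' ?_
      rw [zpow_add_one₀ (by norm_num)]
      linarith
    calc ∫⁻ z in B, f z ≤ ∫⁻ z in Metric.ball y (2 ^ (k + 1)), f z := lintegral_mono_set hsub1
      _ = ∫⁻ z in Metric.ball y (2 ^ (k + 1)), (σ * fun z => f z / σ z) z := by
          refine lintegral_congr_ae (ae_restrict_of_ae ?_)
          filter_upwards [hσ0, hσ1] with z h0 h1
          rw [Pi.mul_apply, ENNReal.mul_div_cancel h0 h1]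
      _ = ∫⁻ z in Metric.ball y (2 ^ (k + 1)), f z / σ z ∂μσ := by
          have hfσ : Measurable fun z => f z / σ z := hf.div hσ
          rw [hμσ, setLIntegral_withDensity_eq_setLIntegral_mul _ hσ hfσ
            Metric.isOpen_ball.measurableSet]
      _ ≤ μσ (Metric.ball y (2 ^ (k + 1))) * Mσ y :=
          setLIntegral_ball_le_mul_centeredMaximal _ _ _ _
            ((measure_mono hsub2).trans_lt hμσ1.lt_top).ne
      _ ≤ _ := by gcongr
  have hMm : Measurable Mσ := measurable_centeredMaximal _ _
  have hΦm : Measurable Φ := (hMm.pow_const _).mul hw.inv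
  -- The bound being uniform in `y ∈ B`, its power `p - 1` is integrated over `B` and rewritten as a
  -- `w`-integral of `Φ`.
  have hstep2 : volume B * (∫⁻ z in B, f z) ^ (p - 1) ≤
      μσ D ^ (p - 1) * (μw D * centeredMaximal μw Φ x) := by
    calc volume B * (∫⁻ z in B, f z) ^ (p - 1)
        = ∫⁻ _ in B, (∫⁻ z in B, f z) ^ (p - 1) := by
          rw [lintegral_const, Measure.restrict_apply_univ, mul_comm]
      _ ≤ ∫⁻ y in B, μσ D ^ (p - 1) * Mσ y ^ (p - 1) := by
          refine setLIntegral_mono' hBm fun y hy => ?_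
          rw [← ENNReal.mul_rpow_of_nonneg _ _ hp1.le]
          gcongr
          exact hstep1 y hy
      _ = μσ D ^ (p - 1) * ∫⁻ y in B, Mσ y ^ (p - 1) := lintegral_const_mul _ (hMm.pow_const _)
      _ = μσ D ^ (p - 1) * ∫⁻ y in B, (w * Φ) y := by
          congr 1
          refine lintegral_congr_ae (ae_restrict_of_ae ?_)
          filter_upwards [hw0, hw1] with z h0 h1
          simp only [Pi.mul_apply, hΦ]
          rw [mul_comm (Mσ z ^ (p - 1)), ← mul_assoc, ENNReal.mul_inv_cancel h0 h1, one_mul]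
      _ = μσ D ^ (p - 1) * ∫⁻ y in B, Φ y ∂μw := by
          rw [hμw, setLIntegral_withDensity_eq_setLIntegral_mul _ hw hΦm hBm]
      _ ≤ μσ D ^ (p - 1) * (μw B * centeredMaximal μw Φ x) := by
          gcongr
          exact setLIntegral_ball_le_mul_centeredMaximal _ _ _ _
            ((measure_mono hBD).trans_lt hμw1.lt_top).ne
      _ ≤ _ := by gcongr
  have hstep3 : μσ D ^ (p - 1) * μw D ≤ K * volume D ^ p := by
    calc μσ D ^ (p - 1) * μw D
        = (volume D ^ (p - 1) * volume D) * (avg D w * avg D σ ^ (p - 1)) := by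
          rw [hσD, hwD, ENNReal.mul_rpow_of_nonneg _ _ hp1.le]
          ring
      _ ≤ (volume D ^ (p - 1) * volume D) * K := by gcongr
      _ = _ := by
          conv_lhs => enter [1, 2]; rw [← ENNReal.rpow_one (volume D)]
          rw [← ENNReal.rpow_add _ _ hVD0 hVD1, sub_add_cancel, mul_comm]
  have hVD : volume D = ENNReal.ofReal (4 ^ n) * volume B := volume_ball_mul x x (by norm_num) _
  obtain ⟨b, hb⟩ := exists_eq_eexp hVB0 hVB1
  calc dyadicAvg volume f k x ^ (p - 1)
      = ((volume B)⁻¹ * ∫⁻ z in B, f z) ^ (p - 1) := rfl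
    _ = eexp (-(b * p)) * (volume B * (∫⁻ z in B, f z) ^ (p - 1)) := by
        rw [ENNReal.mul_rpow_of_nonneg _ _ hp1.le, hb, eexp_inv, eexp_rpow, ← mul_assoc, eexp_mul]
        congr 2
        ring
    _ ≤ eexp (-(b * p)) * (μσ D ^ (p - 1) * (μw D * centeredMaximal μw Φ x)) := by gcongr
    _ = eexp (-(b * p)) * ((μσ D ^ (p - 1) * μw D) * centeredMaximal μw Φ x) := by
        rw [mul_assoc (μσ D ^ (p - 1))]
    _ ≤ eexp (-(b * p)) * ((K * volume D ^ p) * centeredMaximal μw Φ x) := by gcongr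
    _ = (eexp (-(b * p)) * volume B ^ p) *
          (K * ENNReal.ofReal (4 ^ n) ^ p * centeredMaximal μw Φ x) := by
        rw [hVD, ENNReal.mul_rpow_of_nonneg _ _ (by linarith)]
        ring
    _ = _ := by rw [hb, eexp_rpow, eexp_mul, neg_add_cancel, eexp_zero, one_mul]

/-- Muckenhoupt's theorem: the maximal operator is bounded on `L^p(w)` for `w` in `A_p`. -/
theorem exists_lintegral_maximal_rpow_mul_le (n : ℕ) {p : ℝ} (hp : 1 < p) (K : ℝ≥0) :
    ∃ C : ℝ≥0, ∀ w : Rn n → ℝ≥0∞, Measurable w → (∀ᵐ x, w x ≠ 0) → (∀ᵐ x, w x ≠ ∞) →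
      (∀ (x : Rn n) (r : ℝ), 0 < r → avg (Metric.ball x r) w *
        avg (Metric.ball x r) (fun y => w y ^ (1 - p.conjExponent)) ^ (p - 1) ≤ K) →
      ∀ f : Rn n → ℝ≥0∞, Measurable f →
        ∫⁻ x, maximal f x ^ p * w x ≤ C * ∫⁻ x, f x ^ p * w x := by
  have hp0 : 0 < p := by linarith
  have hp1 : 0 < p - 1 := by linarith
  set p' := p / (p - 1) with hp'
  have hp'1 : 1 < p' := by rw [hp', one_lt_div hp1]; linarith
  have hp'0 : 0 < p' := by linarith
  have hpp' : (p - 1) * p' = p := by rw [hp']; field_simp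
  obtain ⟨C₁, hC₁⟩ := exists_strong_type_centeredMaximal n hp
  obtain ⟨C₂, hC₂⟩ := exists_strong_type_centeredMaximal n hp'1
  let A : ℝ≥0∞ := (2 ^ n) ^ p * (K * ENNReal.ofReal (4 ^ n) ^ p) ^ p'
  have hA : A ≠ ∞ := by
    refine ENNReal.mul_ne_top (ENNReal.rpow_ne_top_of_nonneg hp0.le (by simp))
      (ENNReal.rpow_ne_top_of_nonneg hp'0.le (ENNReal.mul_ne_top ENNReal.coe_ne_top
        (ENNReal.rpow_ne_top_of_nonneg hp0.le ENNReal.ofReal_ne_top)))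
  refine ⟨A.toNNReal * C₂ * C₁, fun w hw hw0 hw1 hK f hf => ?_⟩
  let σ : Rn n → ℝ≥0∞ := fun y => w y ^ (1 - p.conjExponent)
  have hσ : Measurable σ := hw.pow_const _
  have hσ01 : ∀ᵐ x, σ x ≠ 0 ∧ σ x ≠ ∞ := by
    filter_upwards [hw0, hw1] with x h0 h1
    obtain ⟨s, hs⟩ := exists_eq_eexp h0 h1
    simp only [σ, hs, eexp_rpow]
    exact ⟨eexp_ne_zero _, eexp_ne_top _⟩
  set μw := volume.withDensity w with hμw
  set μσ := volume.withDensity σ with hμσ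
  set Mσ := centeredMaximal μσ (fun z => f z / σ z) with hMσ
  set Φ : Rn n → ℝ≥0∞ := fun y => Mσ y ^ (p - 1) * (w y)⁻¹ with hΦ
  have hMm : Measurable Mσ := measurable_centeredMaximal _ _
  have hΦm : Measurable Φ := (hMm.pow_const _).mul hw.inv
  have hpt : ∀ x, maximal f x ^ p ≤ A * centeredMaximal μw Φ x ^ p' := by
    intro x
    have h1 : centeredMaximal volume f x ^ (p - 1) ≤
        K * ENNReal.ofReal (4 ^ n) ^ p * centeredMaximal μw Φ x := by
      have h2 : centeredMaximal volume f x ≤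
          (K * ENNReal.ofReal (4 ^ n) ^ p * centeredMaximal μw Φ x) ^ (p - 1)⁻¹ := by
        refine iSup_le fun k => ?_
        rw [ENNReal.le_rpow_inv_iff hp1]
        exact dyadicAvg_rpow_le hp hw hσ hf hw0 hw1 (hσ01.mono fun _ h => h.1)
          (hσ01.mono fun _ h => h.2) hK k x
      rwa [ENNReal.le_rpow_inv_iff hp1] at h2
    calc maximal f x ^ p ≤ (2 ^ n * centeredMaximal volume f x) ^ p := by
          gcongr
          exact maximal_le_mul_centeredMaximal f x
      _ = (2 ^ n) ^ p * (centeredMaximal volume f x ^ (p - 1)) ^ p' := by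
          rw [ENNReal.mul_rpow_of_nonneg _ _ hp0.le, ← ENNReal.rpow_mul, hpp']
      _ ≤ (2 ^ n) ^ p * (K * ENNReal.ofReal (4 ^ n) ^ p * centeredMaximal μw Φ x) ^ p' := by
          gcongr
      _ = _ := by
          rw [ENNReal.mul_rpow_of_nonneg _ _ hp'0.le, ← mul_assoc]
  have hMw : Measurable (centeredMaximal μw Φ) := measurable_centeredMaximal _ _
  calc ∫⁻ x, maximal f x ^ p * w x ≤ ∫⁻ x, A * (w * fun x => centeredMaximal μw Φ x ^ p') x := by
        refine lintegral_mono fun x => ?_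
        rw [Pi.mul_apply, mul_comm (w x), ← mul_assoc]
        gcongr
        exact hpt x
    _ = A * ∫⁻ x, (w * fun x => centeredMaximal μw Φ x ^ p') x :=
        lintegral_const_mul _ (hw.mul (hMw.pow_const _))
    _ = A * ∫⁻ x, centeredMaximal μw Φ x ^ p' ∂μw := by
        rw [hμw, lintegral_withDensity_eq_lintegral_mul _ hw (hMw.pow_const _)]
    _ ≤ A * (C₂ * ∫⁻ x, Φ x ^ p' ∂μw) := by
        gcongr
        exact hC₂ μw Φ hΦm
    -- The dual weight is made for this: `Φ ^ p' * w = Mσ ^ p * w ^ (1 - p') = Mσ ^ p * σ`, and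
    -- later `(f / σ) ^ p * σ = f ^ p * w`.
    _ = A * (C₂ * ∫⁻ x, Mσ x ^ p ∂μσ) := by
        congr 2
        rw [hμw, lintegral_withDensity_eq_lintegral_mul _ hw (hΦm.pow_const _), hμσ,
          lintegral_withDensity_eq_lintegral_mul _ hσ (hMm.pow_const _)]
        refine lintegral_congr_ae ?_
        filter_upwards [hw0, hw1] with x h0 h1
        obtain ⟨s, hs⟩ := exists_eq_eexp h0 h1
        rw [Pi.mul_apply, Pi.mul_apply, hΦ]
        simp only [σ]
        rw [ENNReal.mul_rpow_of_nonneg _ _ hp'0.le, ← ENNReal.rpow_mul, hpp', hs, eexp_inv,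
          eexp_rpow, eexp_rpow, mul_comm (Mσ x ^ p), ← mul_assoc, eexp_mul,
          one_sub_conjExponent hp]
        congr 2
        rw [hp']
        field_simp
        ring
    _ ≤ A * (C₂ * (C₁ * ∫⁻ x, (f x / σ x) ^ p ∂μσ)) := by
        gcongr
        exact hC₁ μσ _ (hf.div hσ)
    _ = A * (C₂ * (C₁ * ∫⁻ x, f x ^ p * w x)) := by
        congr 3
        have hfσ : Measurable fun z => f z / σ z := hf.div hσ
        rw [hμσ, lintegral_withDensity_eq_lintegral_mul _ hσ (hfσ.pow_const _)]
        refine lintegral_congr_ae ?_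
        filter_upwards [hw0, hw1] with x h0 h1
        obtain ⟨s, hs⟩ := exists_eq_eexp h0 h1
        rw [Pi.mul_apply]
        simp only [σ]
        rw [hs, eexp_rpow, div_eq_mul_inv, eexp_inv, ENNReal.mul_rpow_of_nonneg _ _ hp0.le,
          eexp_rpow, mul_comm (f x ^ p), ← mul_assoc, eexp_mul, mul_comm (f x ^ p),
          one_sub_conjExponent hp]
        congr 2
        field_simp
        ring
    _ = _ := by
        rw [ENNReal.coe_mul, ENNReal.coe_mul, ENNReal.coe_toNNReal hA]
        ring

/-- The Rubio de Francia algorithm in `L^p(u v ^ (1 - p))` for `A₁` weights `u` and `v`. -/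
theorem exists_isA1_majorant (n : ℕ) {p : ℝ} (hp : 1 < p) (K L : ℝ≥0) :
    ∃ C : ℝ≥0, ∀ u v : Rn n → ℝ≥0∞, IsA1 K u → IsA1 L v → ∀ k : Rn n → ℝ≥0∞, Measurable k →
      ¬ k =ᵐ[volume] 0 → ∀ m : ℝ≥0∞, m ≠ ∞ → ∫⁻ x, k x ^ p * (u x * v x ^ (1 - p)) ≤ m →
      ∃ V : Rn n → ℝ≥0∞, IsA1 C V ∧ (∀ x, k x ≤ 2 * V x) ∧
        ∫⁻ x, V x ^ p * (u x * v x ^ (1 - p)) ≤ m := by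
  have hp0 : 0 < p := by linarith
  obtain ⟨C, hC⟩ := exists_lintegral_maximal_rpow_mul_le n hp
    (2 ^ n * K * (2 ^ n * L) ^ (p - 1))
  refine ⟨2 * (C + 1), fun u v hu hv k hk hk0 m hm hkm => ?_⟩
  let w : Rn n → ℝ≥0∞ := fun x => u x * v x ^ (1 - p)
  have hw : Measurable w := hu.measurable.mul (hv.measurable.pow_const _)
  have hw01 : ∀ᵐ x, w x ≠ 0 ∧ w x ≠ ∞ := by
    filter_upwards [hu.ae_ne_top, hv.ae_ne_top] with x h1 h2
    obtain ⟨s, hs⟩ := exists_eq_eexp (hu.ne_zero x) h1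
    obtain ⟨t, ht⟩ := exists_eq_eexp (hv.ne_zero x) h2
    simp only [w, hs, ht, eexp_rpow, eexp_mul]
    exact ⟨eexp_ne_zero _, eexp_ne_top _⟩
  have hbd := hC w hw (hw01.mono fun _ h => h.1) (hw01.mono fun _ h => h.2)
    fun x r hr => ((isFat_ball x hr).ap_le hu hv hp).2
  have hint : ∀ F : Rn n → ℝ≥0∞, Measurable F →
      ∫⁻ x, F x ^ p ∂(volume.withDensity w) = ∫⁻ x, F x ^ p * w x := by
    intro F hF
    rw [lintegral_withDensity_eq_lintegral_mul _ hw (hF.pow_const _)]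
    congr 1 with x
    rw [Pi.mul_apply, mul_comm]
  have hCpos : ((C + 1 : ℝ≥0) : ℝ≥0∞) ≠ 0 := by simp
  obtain ⟨V, hVm, hkV, hVi, hVM⟩ := exists_rubioDeFrancia (μ := volume.withDensity w)
    (q := fun _ => p) measurable_const (Filter.Eventually.of_forall fun _ => hp.le)
    (C := C + 1) (by simp) (m := m) (fun F hF hFm => by
      have hMm := measurable_maximal F
      rw [hint F hF] at hFm
      rw [hint _ (hMm.div_const _)]
      calc ∫⁻ x, (maximal F x / (C + 1 : ℝ≥0)) ^ p * w x
          = ∫⁻ x, (((C + 1 : ℝ≥0) : ℝ≥0∞) ^ p)⁻¹ * (maximal F x ^ p * w x) := by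
            congr 1 with x
            rw [ENNReal.div_rpow_of_nonneg _ _ hp0.le, div_eq_mul_inv]
            ring
        _ = (((C + 1 : ℝ≥0) : ℝ≥0∞) ^ p)⁻¹ * ∫⁻ x, maximal F x ^ p * w x :=
            lintegral_const_mul _ ((hMm.pow_const _).mul hw)
        _ ≤ (((C + 1 : ℝ≥0) : ℝ≥0∞) ^ p)⁻¹ * (((C + 1 : ℝ≥0) : ℝ≥0∞) ^ p * m) := by
            gcongr
            refine (hbd F hF).trans ?_
            gcongr
            calc (C : ℝ≥0∞) ≤ ((C + 1 : ℝ≥0) : ℝ≥0∞) := by simp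
              _ = ((C + 1 : ℝ≥0) : ℝ≥0∞) ^ (1 : ℝ) := (ENNReal.rpow_one _).symm
              _ ≤ _ := ENNReal.rpow_le_rpow_of_exponent_le (by simp) hp.le
        _ = m := by
            rw [← mul_assoc, ENNReal.inv_mul_cancel, one_mul]
            · rw [Ne, ENNReal.rpow_eq_zero_iff_of_pos hp0]; exact hCpos
            · exact ENNReal.rpow_ne_top_of_nonneg hp0.le ENNReal.coe_ne_top)
    hk (by rw [hint k hk]; exact hkm)
  rw [hint V hVm] at hVi
  refine ⟨V, ⟨hVm, ?_, ?_, hVM⟩, hkV, hVi⟩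
  · refine ne_zero_of_maximal_le hVm hVM fun h => hk0 ?_
    filter_upwards [h] with x hx
    have := hkV x
    rw [hx] at this
    simpa using this
  · have hlt := ae_lt_top ((hVm.pow_const p).mul hw) (hVi.trans_lt hm.lt_top).ne
    filter_upwards [hlt, hw01] with x h1 h2 h3
    simp only [Pi.mul_apply, h3, ENNReal.top_rpow_of_pos hp0] at h1
    exact h1.ne (ENNReal.top_mul h2.1)

/-! ### Extrapolation with constant exponents -/

theorem measurable_rpow_mul {f u : Rn n → ℝ≥0∞} (hf : Measurable f) (hu : Measurable u) (a : ℝ) :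
    Measurable fun x => f x ^ a * u x :=
  (hf.pow_const a).mul hu

theorem measurable_rpow_mul_rpow {f u : Rn n → ℝ≥0∞} (hf : Measurable f) (hu : Measurable u)
    (a b : ℝ) : Measurable fun x => f x ^ a * u x ^ b :=
  (hf.pow_const a).mul (hu.pow_const b)

theorem avg_congr_ae {E : Set (Rn n)} {f g : Rn n → ℝ≥0∞} (h : f =ᵐ[volume] g) :
    avg E f = avg E g := by
  rw [avg, avg, lintegral_congr_ae (ae_restrict_of_ae h)]

/-- The product weight may be infinite on a null set; `toNNReal` changes it only there.
`IsFat.ap_le` gives local integrability on balls and the `A_{p₀}` bound on cubes. -/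
theorem WeightedIneq.exists_const {F : Set ((Rn n → ℝ≥0∞) × (Rn n → ℝ≥0∞))} {p₀ δ : ℝ}
    (h : WeightedIneq F p₀ δ) (hp₀ : 1 < p₀) (K L : ℝ≥0) :
    ∃ C : ℝ≥0, ∀ u v : Rn n → ℝ≥0∞, IsA1 K u → IsA1 L v → ∀ f g : Rn n → ℝ≥0∞, (f, g) ∈ F →
      ∫⁻ x, f x ^ p₀ * (u x * v x ^ (1 - p₀)) ^ δ < ∞ →
      ∫⁻ x, f x ^ p₀ * (u x * v x ^ (1 - p₀)) ^ δ ≤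
        C * ∫⁻ x, g x ^ p₀ * (u x * v x ^ (1 - p₀)) ^ δ := by
  obtain ⟨C₀, hC₀⟩ := h
  let c : ℝ≥0 := (2 * (n + 1)) ^ n
  let A : ℝ≥0 := c * K * (c * L) ^ (p₀ - 1)
  refine ⟨C₀ A, fun u v hu hv f g hfg hfin => ?_⟩
  let w : Rn n → ℝ≥0∞ := fun x => u x * v x ^ (1 - p₀)
  have hwm : Measurable w := hu.measurable.mul (hv.measurable.pow_const _)
  have hw : (fun x => ((w x).toNNReal : ℝ≥0∞)) =ᵐ[volume] w := by
    filter_upwards [hu.ae_ne_top, hv.ae_ne_top] with x h1 h2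
    refine ENNReal.coe_toNNReal ?_
    obtain ⟨s, hs⟩ := exists_eq_eexp (hu.ne_zero x) h1
    obtain ⟨t, ht⟩ := exists_eq_eexp (hv.ne_zero x) h2
    simp only [w, hs, ht, eexp_rpow, eexp_mul]
    exact eexp_ne_top _
  have hint : ∀ φ : Rn n → ℝ≥0∞, ∫⁻ x, φ x ^ p₀ * ((w x).toNNReal : ℝ≥0∞) ^ δ =
      ∫⁻ x, φ x ^ p₀ * (u x * v x ^ (1 - p₀)) ^ δ := by
    intro φ
    refine lintegral_congr_ae ?_
    filter_upwards [hw] with x hx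
    rw [hx]
  have hweight : IsWeight fun x => (w x).toNNReal := by
    intro x
    refine ⟨Metric.ball x 1, Metric.ball_mem_nhds x one_pos,
      hwm.ennreal_toNNReal.coe_nnreal_real.aestronglyMeasurable, ?_⟩
    have hfat := isFat_ball x one_pos
    rw [hasFiniteIntegral_iff_enorm]
    calc ∫⁻ y in Metric.ball x 1, ‖((w y).toNNReal : ℝ)‖ₑ ≤ ∫⁻ y in Metric.ball x 1, w y := by
          refine lintegral_mono fun y => ?_
          rw [NNReal.enorm_eq]
          exact ENNReal.coe_toNNReal_le_self
      _ = volume (Metric.ball x 1) * avg (Metric.ball x 1) w := by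
          rw [avg, ← mul_assoc, ENNReal.mul_inv_cancel hfat.volume_ne_zero hfat.volume_ne_top,
            one_mul]
      _ < ∞ := ENNReal.mul_lt_top hfat.volume_ne_top.lt_top (hfat.ap_le hu hv hp₀).1.lt_top
  have hap : apConst p₀ (fun x => (w x).toNNReal) ≤ A := by
    refine iSup_le fun a => iSup₂_le fun l hl => ?_
    have hw' : (fun x => ((w x).toNNReal : ℝ≥0∞) ^ (1 - p₀.conjExponent)) =ᵐ[volume]
        fun x => w x ^ (1 - p₀.conjExponent) := by
      filter_upwards [hw] with x hx
      rw [hx]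
    rw [avg_congr_ae hw, avg_congr_ae hw']
    exact ((isFat_cube a hl).ap_le hu hv hp₀).2
  have := hC₀ A _ hweight hap f g hfg
  rw [hint, hint] at this
  exact this hfin

theorem exists_extrapolation_eq {F : Set ((Rn n → ℝ≥0∞) × (Rn n → ℝ≥0∞))}
    {p₀ δ : ℝ} (h : WeightedIneq F p₀ δ) (hp₀ : 1 < p₀) (K : ℝ≥0) :
    ∃ C : ℝ≥0, ∀ H : Rn n → ℝ≥0∞, IsA1 K H → ∀ f g : Rn n → ℝ≥0∞, (f, g) ∈ F →
      ∫⁻ x, f x ^ p₀ * H x ^ δ < ∞ →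
      ∫⁻ x, f x ^ p₀ * H x ^ δ ≤ C * ∫⁻ x, g x ^ p₀ * H x ^ δ := by
  obtain ⟨C, hC⟩ := h.exists_const hp₀ K 1
  refine ⟨C, fun H hH f g hfg hfin => ?_⟩
  simpa using hC H (fun _ => 1) hH isA1_one f g hfg (by simpa using hfin)

/-- Let `w = H * V ^ (1 - p₀)`. If `φ` is at most a constant times `V ^ e * H ^ c`, then replacing
`φ ^ (p₀ - ps)` in `φ ^ p₀ * w ^ δ` leaves `φ ^ ps` times powers of `V` and `H`: `e` is chosen to
cancel `V`, and `c` to make the power of `H` equal to `δs`. With `r = e * ps`, `V` is sought in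
`L^r(H)`; `1 < r` is the lower bound on `ps`. -/
theorem exists_extrapolation_of_lt {F : Set ((Rn n → ℝ≥0∞) × (Rn n → ℝ≥0∞))}
    (hF : ∀ f g : Rn n → ℝ≥0∞, (f, g) ∈ F → Measurable f ∧ Measurable g)
    {p₀ δ : ℝ} (h : WeightedIneq F p₀ δ) (hδ₀ : 0 < δ) (hδ₁ : δ < 1) (hp₀ : 1 < p₀)
    {ps δs : ℝ} (hps : p₀ / (1 + δ * (p₀ - 1)) < ps) (hlt : ps < p₀)
    (hδs : δs = (p₀ - ps * (1 - δ)) / p₀) (K : ℝ≥0) :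
    ∃ C : ℝ≥0, ∀ H : Rn n → ℝ≥0∞, IsA1 K H → ∀ f g : Rn n → ℝ≥0∞, (f, g) ∈ F →
      ∫⁻ x, f x ^ ps * H x ^ δs < ∞ →
      ∫⁻ x, f x ^ ps * H x ^ δs ≤ C * ∫⁻ x, g x ^ ps * H x ^ δs := by
  have hp0 : 0 < p₀ := by linarith
  have hp1 : 0 < p₀ - 1 := by linarith
  have hd : 0 < p₀ - ps := by linarith
  have hδp : 0 < δ * (p₀ - 1) := by positivity
  have hps0 : 0 < ps := lt_trans (by positivity) hps
  rw [div_lt_iff₀ (by positivity)] at hps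
  set e := δ * (p₀ - 1) / (p₀ - ps) with he
  have he0 : 0 < e := by positivity
  have hed : e * (p₀ - ps) = δ * (p₀ - 1) := by rw [he]; field_simp
  set r := e * ps with hr
  have hr1 : 1 < r := by
    rw [hr, he, div_mul_eq_mul_div, one_lt_div hd]
    nlinarith
  have hr0 : 0 < r := by linarith
  set c := (1 - δ) / p₀ with hc
  have hcδ : 1 - ps * c = δs := by rw [hc, hδs]; field_simp
  obtain ⟨L, hL⟩ := exists_isA1_majorant n hr1 K 1
  obtain ⟨C₀, hC₀⟩ := h.exists_const hp₀ K L
  let D : ℝ≥0∞ := (C₀ * 2 ^ (δ * (p₀ - 1))) ^ (ps / p₀) * 2 ^ (1 - ps / p₀)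
  have hθ0 : 0 < ps / p₀ := by positivity
  have hθ1 : ps / p₀ < 1 := (div_lt_one hp0).2 hlt
  have hD : D ≠ ∞ := by
    refine ENNReal.mul_ne_top (ENNReal.rpow_ne_top_of_nonneg hθ0.le (ENNReal.mul_ne_top
      ENNReal.coe_ne_top (ENNReal.rpow_ne_top_of_nonneg hδp.le (by simp))))
      (ENNReal.rpow_ne_top_of_nonneg (by linarith) (by simp))
  refine ⟨D.toNNReal + 1, fun H hH f g hfg hfin => ?_⟩
  obtain ⟨hf, hg⟩ := hF f g hfg
  set A := ∫⁻ x, f x ^ ps * H x ^ δs with hA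
  set B := ∫⁻ x, g x ^ ps * H x ^ δs with hB
  by_cases hA0 : A = 0
  · rw [hA0]
    exact zero_le
  obtain ⟨α, hα⟩ := exists_eq_eexp hA0 hfin.ne
  -- As `B` may be `0` or `∞`, `g` is normalised by an arbitrary `eexp β ≥ B`, and `β` is optimised
  -- at the end.
  have main : ∀ β : ℝ, B ≤ eexp β → A ≤ D * eexp β := by
    intro β hβ
    let k : (Rn n → ℝ≥0∞) → ℝ → Rn n → ℝ≥0∞ := fun φ γ x =>
      (φ x * eexp (-γ / ps)) ^ (1 / e) * H x ^ (-c / e)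
    have hkm : ∀ φ γ, Measurable φ → Measurable (k φ γ) := fun φ γ hφ =>
      ((hφ.mul_const _).pow_const _).mul (hH.measurable.pow_const _)
    have hki : ∀ φ γ, Measurable φ → ∫⁻ x, k φ γ x ^ r * H x =
        eexp (-γ) * ∫⁻ x, φ x ^ ps * H x ^ δs := by
      intro φ γ hφ
      rw [← lintegral_const_mul _ (measurable_rpow_mul_rpow hφ hH.measurable ps δs)]
      refine lintegral_congr_ae ?_
      filter_upwards [hH.ae_ne_top] with x hx
      obtain ⟨s, hs⟩ := exists_eq_eexp (hH.ne_zero x) hx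
      simp only [k]
      rw [hs, ENNReal.mul_rpow_of_nonneg _ _ hr0.le, ← ENNReal.rpow_mul,
        ENNReal.mul_rpow_of_nonneg _ _ (by positivity)]
      have e1 : 1 / e * r = ps := by rw [hr]; field_simp
      rw [e1, eexp_rpow, eexp_rpow, eexp_rpow, eexp_rpow, mul_assoc, mul_assoc, eexp_mul, eexp_mul,
        mul_left_comm (eexp (-γ)), eexp_mul]
      congr 2
      rw [← hcδ, hr]
      field_simp
      ring
    have hk1 : ∫⁻ x, k f α x ^ r * H x = 1 := by
      rw [hki f α hf, ← hA, hα, eexp_mul, neg_add_cancel, eexp_zero]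
    have hk2 : ∫⁻ x, k g β x ^ r * H x ≤ 1 := by
      rw [hki g β hg, ← hB]
      calc eexp (-β) * B ≤ eexp (-β) * eexp β := by gcongr
        _ = 1 := by rw [eexp_mul, neg_add_cancel, eexp_zero]
    -- The majorant covers both functions: `g` for the estimate, `f` for the finiteness that the
    -- hypothesis demands.
    obtain ⟨V, hV, hkV, hVi⟩ := hL H (fun _ => 1) hH isA1_one
      (fun x => max (k f α x) (k g β x)) ((hkm f α hf).max (hkm g β hg)) (by
        intro h0
        have : ∫⁻ x, k f α x ^ r * H x = 0 := by
          rw [lintegral_eq_zero_iff (measurable_rpow_mul (hkm f α hf) hH.measurable r)]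
          filter_upwards [h0] with x hx
          have h1 : k f α x = 0 := le_antisymm ((le_max_left _ _).trans_eq hx) zero_le
          simp [h1, hr0]
        rw [hk1] at this
        exact one_ne_zero this) 2 (by simp) (by
        calc ∫⁻ x, max (k f α x) (k g β x) ^ r * (H x * 1 ^ (1 - r))
            ≤ ∫⁻ x, (k f α x ^ r * H x + k g β x ^ r * H x) := by
              refine lintegral_mono fun x => ?_
              rw [ENNReal.one_rpow, mul_one, ← add_mul]
              gcongr
              rcases max_choice (k f α x) (k g β x) with h1 | h1 <;> rw [h1]
              · exact le_self_add
              · exact le_add_self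
          _ = (∫⁻ x, k f α x ^ r * H x) + ∫⁻ x, k g β x ^ r * H x :=
              lintegral_add_left (measurable_rpow_mul (hkm f α hf) hH.measurable r) _
          _ ≤ 1 + 1 := by rw [hk1]; gcongr
          _ = 2 := one_add_one_eq_two)
    simp only [ENNReal.one_rpow, mul_one] at hVi
    have hdom : ∀ φ γ, Measurable φ → (∀ x, k φ γ x ≤ 2 * V x) →
        ∫⁻ x, φ x ^ p₀ * (H x * V x ^ (1 - p₀)) ^ δ ≤
          2 ^ (δ * (p₀ - 1)) * eexp (γ * (p₀ - ps) / ps) * ∫⁻ x, φ x ^ ps * H x ^ δs := by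
      intro φ γ hφ hle
      rw [← lintegral_const_mul _ (measurable_rpow_mul_rpow hφ hH.measurable ps δs)]
      refine lintegral_mono_ae ?_
      filter_upwards [hH.ae_ne_top, hV.ae_ne_top] with x hHx hVx
      have hx := hle x
      obtain ⟨s, hs⟩ := exists_eq_eexp (hH.ne_zero x) hHx
      obtain ⟨t, ht⟩ := exists_eq_eexp (hV.ne_zero x) hVx
      simp only [k] at hx
      rw [hs, ht, eexp_rpow] at hx
      have h1 : φ x ≤ eexp (γ / ps + t * e + s * c) * 2 ^ e := by
        calc φ x = (((φ x * eexp (-γ / ps)) ^ (1 / e) * eexp (s * (-c / e))) *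
              eexp (-(s * (-c / e)))) ^ e * eexp (γ / ps) := by
              rw [mul_assoc (_ ^ (1 / e)), eexp_mul, add_neg_cancel, eexp_zero, mul_one,
                ← ENNReal.rpow_mul, one_div_mul_cancel he0.ne', ENNReal.rpow_one, mul_assoc,
                eexp_mul, neg_div, neg_add_cancel, eexp_zero, mul_one]
          _ ≤ ((2 * eexp t) * eexp (-(s * (-c / e)))) ^ e * eexp (γ / ps) := by
              gcongr
          _ = _ := by
              rw [mul_assoc, eexp_mul, ENNReal.mul_rpow_of_nonneg _ _ he0.le, eexp_rpow, mul_assoc,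
                eexp_mul, mul_comm]
              congr 2
              field_simp
              ring
      calc φ x ^ p₀ * (H x * V x ^ (1 - p₀)) ^ δ
          = φ x ^ ps * φ x ^ (p₀ - ps) * eexp ((s + t * (1 - p₀)) * δ) := by
            rw [hs, ht, eexp_rpow, eexp_mul, eexp_rpow,
              ← ENNReal.rpow_add_of_nonneg _ _ hps0.le hd.le, add_sub_cancel]
        _ ≤ φ x ^ ps * (eexp (γ / ps + t * e + s * c) * 2 ^ e) ^ (p₀ - ps) *
              eexp ((s + t * (1 - p₀)) * δ) := by
            gcongr
        _ = 2 ^ (δ * (p₀ - 1)) * φ x ^ ps * (eexp ((γ / ps + t * e + s * c) * (p₀ - ps)) *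
              eexp ((s + t * (1 - p₀)) * δ)) := by
            rw [ENNReal.mul_rpow_of_nonneg _ _ hd.le, ← ENNReal.rpow_mul, hed, eexp_rpow]
            ring
        _ = 2 ^ (δ * (p₀ - 1)) * φ x ^ ps * (eexp (γ * (p₀ - ps) / ps) * eexp (s * δs)) := by
            rw [eexp_mul, eexp_mul]
            congr 2
            have e2 : δs = δ + c * (p₀ - ps) := by rw [← hcδ, hc]; field_simp; ring
            rw [e2]
            linear_combination t * hed
        _ = _ := by
            rw [hs, eexp_rpow]
            ring
    have hwf := hdom f α hf fun x => (le_max_left _ _).trans (hkV x)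
    have hwg := hdom g β hg fun x => (le_max_right _ _).trans (hkV x)
    have hX : ∫⁻ x, f x ^ p₀ * (H x * V x ^ (1 - p₀)) ^ δ ≤
        C₀ * 2 ^ (δ * (p₀ - 1)) * eexp (β * p₀ / ps) := by
      refine (hC₀ H V hH hV f g hfg (hwf.trans_lt ?_)).trans ?_
      · exact ENNReal.mul_lt_top (ENNReal.mul_lt_top
          (ENNReal.rpow_ne_top_of_nonneg hδp.le (by simp)).lt_top (eexp_ne_top _).lt_top) hfin
      · calc _ ≤ C₀ * (2 ^ (δ * (p₀ - 1)) * eexp (β * (p₀ - ps) / ps) * eexp β) := by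
              gcongr
              exact hwg.trans (by gcongr)
          _ = _ := by
              rw [mul_assoc (2 ^ _), eexp_mul, mul_assoc]
              congr 3
              field_simp
              ring
    calc A = ∫⁻ x, (f x ^ p₀ * (H x * V x ^ (1 - p₀)) ^ δ) ^ (ps / p₀) *
          (V x ^ r * H x) ^ (1 - ps / p₀) := by
          refine lintegral_congr_ae ?_
          filter_upwards [hH.ae_ne_top, hV.ae_ne_top] with x hHx hVx
          obtain ⟨s, hs⟩ := exists_eq_eexp (hH.ne_zero x) hHx
          obtain ⟨t, ht⟩ := exists_eq_eexp (hV.ne_zero x) hVx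
          rw [hs, ht, ENNReal.mul_rpow_of_nonneg _ _ hθ0.le, ← ENNReal.rpow_mul,
            mul_div_cancel₀ _ hp0.ne']
          simp only [eexp_rpow, eexp_mul, mul_assoc]
          congr 2
          rw [← hcδ, hc, hr, he]
          field_simp
          ring
      _ ≤ (∫⁻ x, f x ^ p₀ * (H x * V x ^ (1 - p₀)) ^ δ) ^ (ps / p₀) *
          (∫⁻ x, V x ^ r * H x) ^ (1 - ps / p₀) := by
          refine ENNReal.lintegral_mul_norm_pow_le ?_ ?_ hθ0.le (by linarith) (by ring)
          · exact ((hf.pow_const _).mul ((hH.measurable.mul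
              (hV.measurable.pow_const _)).pow_const _)).aemeasurable
          · exact ((hV.measurable.pow_const _).mul hH.measurable).aemeasurable
      _ ≤ (C₀ * 2 ^ (δ * (p₀ - 1)) * eexp (β * p₀ / ps)) ^ (ps / p₀) * 2 ^ (1 - ps / p₀) := by
          gcongr
      _ = D * eexp β := by
          rw [ENNReal.mul_rpow_of_nonneg _ _ hθ0.le, eexp_rpow,
            show β * p₀ / ps * (ps / p₀) = β by field_simp]
          simp only [D]
          ring
  have hDle : D ≤ ((D.toNNReal + 1 : ℝ≥0) : ℝ≥0∞) := by
    rw [ENNReal.coe_add, ENNReal.coe_toNNReal hD]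
    exact le_self_add
  have hD0 : ((D.toNNReal + 1 : ℝ≥0) : ℝ≥0∞) ≠ 0 := by simp
  rw [← ENNReal.div_le_iff' hD0 ENNReal.coe_ne_top]
  refine le_of_forall_gt_imp_ge_of_dense fun b hb => ?_
  by_cases hbt : b = ∞
  · rw [hbt]; exact le_top
  obtain ⟨β, rfl⟩ := exists_eq_eexp (ne_bot_of_gt hb) hbt
  rw [ENNReal.div_le_iff' hD0 ENNReal.coe_ne_top]
  exact (main β hb.le).trans (by gcongr)

/-- Write `f ^ ps * H ^ δs = f ^ p₀ * k ^ δ` and majorise `k` by an `A₁` weight `V` in `L^r(H ^ (1 -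
r))`. Testing on `V` and applying Hölder to the `g` side gives `A ≤ c * B ^ θ * A ^ (1 - θ)`, and `0
< A < ∞` allows division. Here `1 < r` is the upper bound on `ps`. -/
theorem exists_extrapolation_of_gt {F : Set ((Rn n → ℝ≥0∞) × (Rn n → ℝ≥0∞))}
    (hF : ∀ f g : Rn n → ℝ≥0∞, (f, g) ∈ F → Measurable f ∧ Measurable g)
    {p₀ δ : ℝ} (h : WeightedIneq F p₀ δ) (hδ₀ : 0 < δ) (hδ₁ : δ < 1) (hp₀ : 1 < p₀)
    {ps δs : ℝ} (hgt : p₀ < ps) (hps : ps < p₀ / (1 - δ))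
    (hδs : δs = (p₀ - ps * (1 - δ)) / p₀) (K : ℝ≥0) :
    ∃ C : ℝ≥0, ∀ H : Rn n → ℝ≥0∞, IsA1 K H → ∀ f g : Rn n → ℝ≥0∞, (f, g) ∈ F →
      ∫⁻ x, f x ^ ps * H x ^ δs < ∞ →
      ∫⁻ x, f x ^ ps * H x ^ δs ≤ C * ∫⁻ x, g x ^ ps * H x ^ δs := by
  have hp0 : 0 < p₀ := by linarith
  have hd : 0 < ps - p₀ := by linarith
  have hps0 : 0 < ps := by linarith
  rw [lt_div_iff₀ (by linarith)] at hps
  have hδs0 : 0 < δs := by rw [hδs]; apply div_pos <;> linarith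
  set r := δ * ps / (ps - p₀) with hr
  have hr1 : 1 < r := by
    rw [hr, one_lt_div hd]
    linarith
  have hr0 : 0 < r := by linarith
  have hrδ : r - 1 = δs * p₀ / (ps - p₀) := by rw [hr, hδs]; field_simp; ring
  obtain ⟨L, hL⟩ := exists_isA1_majorant n hr1 1 K
  obtain ⟨C₀, hC₀⟩ := h.exists_const hp₀ L 1
  set θ := p₀ / ps with hθ
  have hθ0 : 0 < θ := by positivity
  have hθ1 : θ < 1 := (div_lt_one hps0).2 hgt
  let D : ℝ≥0∞ := (2 ^ δ * C₀) ^ θ⁻¹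
  have hD : D ≠ ∞ := by
    refine ENNReal.rpow_ne_top_of_nonneg (by positivity) (ENNReal.mul_ne_top
      (ENNReal.rpow_ne_top_of_nonneg hδ₀.le (by simp)) ENNReal.coe_ne_top)
  refine ⟨D.toNNReal, fun H hH f g hfg hfin => ?_⟩
  rw [ENNReal.coe_toNNReal hD]
  obtain ⟨hf, hg⟩ := hF f g hfg
  set A := ∫⁻ x, f x ^ ps * H x ^ δs with hA
  set B := ∫⁻ x, g x ^ ps * H x ^ δs with hB
  by_cases hA0 : A = 0
  · rw [hA0]
    exact zero_le
  obtain ⟨α, hα⟩ := exists_eq_eexp hA0 hfin.ne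
  let k : Rn n → ℝ≥0∞ := fun x => f x ^ ((ps - p₀) / δ) * H x ^ (δs / δ)
  have hkm : Measurable k := (hf.pow_const _).mul (hH.measurable.pow_const _)
  have hAk : ∀ x, f x ^ ps * H x ^ δs = f x ^ p₀ * k x ^ δ := by
    intro x
    simp only [k]
    rw [ENNReal.mul_rpow_of_nonneg _ _ hδ₀.le, ← ENNReal.rpow_mul, ← ENNReal.rpow_mul,
      div_mul_cancel₀ _ hδ₀.ne', div_mul_cancel₀ _ hδ₀.ne', ← mul_assoc,
      ← ENNReal.rpow_add_of_nonneg _ _ hp0.le hd.le, add_sub_cancel]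
  obtain ⟨V, hV, hkV, hVi⟩ := hL (fun _ => 1) H isA1_one hH k hkm (by
      intro h0
      apply hA0
      rw [hA, lintegral_eq_zero_iff (measurable_rpow_mul_rpow hf hH.measurable ps δs)]
      filter_upwards [h0] with x hx
      rw [hAk, hx]
      simp [hδ₀]) A hfin.ne (by
      refine le_of_eq (lintegral_congr_ae ?_)
      filter_upwards [hH.ae_ne_top] with x hx
      obtain ⟨s, hs⟩ := exists_eq_eexp (hH.ne_zero x) hx
      simp only [k]
      rw [hs, one_mul, ENNReal.mul_rpow_of_nonneg _ _ hr0.le, ← ENNReal.rpow_mul]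
      simp only [eexp_rpow]
      rw [mul_assoc, eexp_mul]
      congr 2
      · rw [hr]; field_simp
      · have e1 : 1 - r = -(δs * p₀ / (ps - p₀)) := by linarith
        rw [e1, hr]
        field_simp
        ring)
  simp only [one_mul] at hVi
  have hHolder : ∀ φ : Rn n → ℝ≥0∞, Measurable φ → ∫⁻ x, φ x ^ p₀ * (V x * 1 ^ (1 - p₀)) ^ δ ≤
      (∫⁻ x, φ x ^ ps * H x ^ δs) ^ θ * A ^ (1 - θ) := by
    intro φ hφ
    calc ∫⁻ x, φ x ^ p₀ * (V x * 1 ^ (1 - p₀)) ^ δ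
        = ∫⁻ x, (φ x ^ ps * H x ^ δs) ^ θ * (V x ^ r * H x ^ (1 - r)) ^ (1 - θ) := by
          refine lintegral_congr_ae ?_
          filter_upwards [hH.ae_ne_top, hV.ae_ne_top] with x hHx hVx
          obtain ⟨s, hs⟩ := exists_eq_eexp (hH.ne_zero x) hHx
          obtain ⟨t, ht⟩ := exists_eq_eexp (hV.ne_zero x) hVx
          rw [hs, ht, ENNReal.mul_rpow_of_nonneg _ _ hθ0.le, ← ENNReal.rpow_mul,
            ENNReal.one_rpow, mul_one, show ps * θ = p₀ by rw [hθ]; field_simp]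
          simp only [eexp_rpow, eexp_mul, mul_assoc]
          congr 2
          have e1 : 1 - r = -(δs * p₀ / (ps - p₀)) := by linarith
          rw [e1, hr, hθ]
          field_simp
          ring
      _ ≤ (∫⁻ x, φ x ^ ps * H x ^ δs) ^ θ * (∫⁻ x, V x ^ r * H x ^ (1 - r)) ^ (1 - θ) := by
          refine ENNReal.lintegral_mul_norm_pow_le ?_ ?_ hθ0.le (by linarith) (by ring)
          · exact ((hφ.pow_const _).mul (hH.measurable.pow_const _)).aemeasurable
          · exact ((hV.measurable.pow_const _).mul (hH.measurable.pow_const _)).aemeasurable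
      _ ≤ _ := by
          gcongr
  have hX : ∫⁻ x, f x ^ p₀ * (V x * 1 ^ (1 - p₀)) ^ δ < ∞ := by
    refine (hHolder f hf).trans_lt ?_
    rw [← hA, hα, eexp_rpow, eexp_rpow, eexp_mul]
    exact (eexp_ne_top _).lt_top
  have hfinal : A ≤ 2 ^ δ * C₀ * B ^ θ * A ^ (1 - θ) := by
    calc A ≤ ∫⁻ x, 2 ^ δ * (f x ^ p₀ * (V x * 1 ^ (1 - p₀)) ^ δ) := by
          refine lintegral_mono fun x => ?_
          dsimp only
          rw [hAk, ENNReal.one_rpow, mul_one, mul_left_comm, ← ENNReal.mul_rpow_of_nonneg _ _ hδ₀.le]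
          gcongr
          exact hkV x
      _ = 2 ^ δ * ∫⁻ x, f x ^ p₀ * (V x * 1 ^ (1 - p₀)) ^ δ :=
          lintegral_const_mul _ ((hf.pow_const _).mul ((hV.measurable.mul_const _).pow_const _))
      _ ≤ 2 ^ δ * (C₀ * (B ^ θ * A ^ (1 - θ))) := by
          gcongr
          refine (hC₀ V (fun _ => 1) hV isA1_one f g hfg hX).trans ?_
          gcongr
          exact hHolder g hg
      _ = _ := by ring
  have hθA : A ^ θ ≤ 2 ^ δ * C₀ * B ^ θ := by
    rw [hα] at hfinal ⊢
    calc eexp α ^ θ = eexp α * eexp (-(α * (1 - θ))) := by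
          rw [eexp_rpow, eexp_mul]; ring_nf
      _ ≤ (2 ^ δ * C₀ * B ^ θ * eexp α ^ (1 - θ)) * eexp (-(α * (1 - θ))) := by gcongr
      _ = _ := by
          rw [eexp_rpow, mul_assoc, eexp_mul, add_neg_cancel, eexp_zero, mul_one]
  calc A = (A ^ θ) ^ θ⁻¹ := by rw [← ENNReal.rpow_mul, mul_inv_cancel₀ hθ0.ne', ENNReal.rpow_one]
    _ ≤ (2 ^ δ * C₀ * B ^ θ) ^ θ⁻¹ := by gcongr
    _ = D * B := by
        rw [ENNReal.mul_rpow_of_nonneg _ _ (by positivity), ← ENNReal.rpow_mul,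
          mul_inv_cancel₀ hθ0.ne', ENNReal.rpow_one]

/-- Limited range extrapolation with constant exponents, from the exponent `p₀` and weights
`w ^ δ` with `w ∈ A_{p₀}` to the exponent `ps` and weights `H ^ δs` with `H ∈ A₁`. -/
theorem exists_extrapolation {F : Set ((Rn n → ℝ≥0∞) × (Rn n → ℝ≥0∞))}
    (hF : ∀ f g : Rn n → ℝ≥0∞, (f, g) ∈ F → Measurable f ∧ Measurable g)
    {p₀ δ : ℝ} (h : WeightedIneq F p₀ δ) (hδ₀ : 0 < δ) (hδ₁ : δ < 1) (hp₀ : 1 < p₀)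
    {ps δs : ℝ} (hps : p₀ / (1 + δ * (p₀ - 1)) < ps) (hps' : ps < p₀ / (1 - δ))
    (hδs : δs = (p₀ - ps * (1 - δ)) / p₀) (K : ℝ≥0) :
    ∃ C : ℝ≥0, ∀ H : Rn n → ℝ≥0∞, IsA1 K H → ∀ f g : Rn n → ℝ≥0∞, (f, g) ∈ F →
      ∫⁻ x, f x ^ ps * H x ^ δs < ∞ →
      ∫⁻ x, f x ^ ps * H x ^ δs ≤ C * ∫⁻ x, g x ^ ps * H x ^ δs := by
  rcases lt_trichotomy ps p₀ with hlt | rfl | hgt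
  · exact exists_extrapolation_of_lt hF h hδ₀ hδ₁ hp₀ hps hlt hδs K
  · have : δs = δ := by
      have : ps ≠ 0 := by linarith
      rw [hδs]
      field_simp
      ring
    rw [this]
    exact exists_extrapolation_eq h hp₀ K
  · exact exists_extrapolation_of_gt hF h hδ₀ hδ₁ hp₀ hgt hps' hδs K

/-! ### Luxemburg norms -/

theorem lpNorm_le_ofReal {p : Rn n → ℝ} {f : Rn n → ℝ≥0∞} {t : ℝ} (ht : 0 < t)
    (h : modular p (fun x => f x / ENNReal.ofReal t) ≤ 1) : lpNorm p f ≤ ENNReal.ofReal t :=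
  iInf_le_of_le t (iInf₂_le ht h)

theorem modular_le_one_of_lpNorm_lt {p : Rn n → ℝ} (hp : ∀ᵐ x, 0 ≤ p x) {f : Rn n → ℝ≥0∞}
    {a : ℝ≥0∞} (h : lpNorm p f < a) : modular p (fun x => f x / a) ≤ 1 := by
  simp only [lpNorm, iInf_lt_iff] at h
  obtain ⟨t, -, ht, hta⟩ := h
  refine le_trans ?_ ht
  refine lintegral_mono_ae ?_
  filter_upwards [hp] with x hx
  gcongr

theorem lpNorm_ne_top {p : Rn n → ℝ} {ps : ℝ} (hps : 0 < ps) (hp : ∀ᵐ x, ps < p x)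
    {f : Rn n → ℝ≥0∞} (hf : MemLpVar p f) : lpNorm p f ≠ ∞ := by
  obtain ⟨-, t, ht, hfin⟩ := hf
  set m := modular p (fun x => f x / ENNReal.ofReal t) with hm
  -- Since `L ≥ 1` and `p x > ps`, dilating by `L` divides the modular by at least `L ^ ps = m + 1`.
  set L : ℝ := (m.toReal + 1) ^ ps⁻¹ with hL
  have hL1 : 1 ≤ L := Real.one_le_rpow (by linarith [m.toReal_nonneg]) (by positivity)
  have hL0 : 0 < L := by linarith
  have hLps : ENNReal.ofReal L ^ ps = m + 1 := by
    rw [ENNReal.ofReal_rpow_of_pos hL0, hL, ← Real.rpow_mul (by positivity),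
      inv_mul_cancel₀ hps.ne', Real.rpow_one, ENNReal.ofReal_add ENNReal.toReal_nonneg zero_le_one,
      ENNReal.ofReal_toReal hfin.ne, ENNReal.ofReal_one]
  refine ((lpNorm_le_ofReal (t := t * L) (by positivity) ?_).trans_lt ENNReal.ofReal_lt_top).ne
  calc modular p (fun x => f x / ENNReal.ofReal (t * L))
      ≤ ∫⁻ x, (m + 1)⁻¹ * (f x / ENNReal.ofReal t) ^ p x := by
        refine lintegral_mono_ae ?_
        filter_upwards [hp] with x hx
        have hpx : 0 ≤ p x := by linarith
        rw [ENNReal.ofReal_mul ht.le, div_eq_mul_inv, ENNReal.mul_inv (Or.inr ENNReal.ofReal_ne_top)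
          (Or.inl ENNReal.ofReal_ne_top), ← mul_assoc,
          ENNReal.mul_rpow_of_nonneg _ _ hpx, mul_comm, ← div_eq_mul_inv, ← hLps, ENNReal.inv_rpow]
        gcongr
        rwa [ENNReal.one_le_ofReal]
    _ = (m + 1)⁻¹ * m := by
        rw [lintegral_const_mul' _ _ (ENNReal.inv_ne_top.2 (by simp))]
        rfl
    _ ≤ (m + 1)⁻¹ * (m + 1) := by gcongr; exact le_self_add
    _ ≤ 1 := ENNReal.inv_mul_le_one _

/-- Young's inequality for the conjugate exponents `p / ps` and `p / (p - ps)`, by replacing the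
smaller of `y ^ δs` and `x ^ (p - ps)` with the larger. The constants do not depend on `p`, so it
integrates with a variable exponent. -/
theorem rpow_mul_rpow_le_add {p ps δs : ℝ} (hps : 0 < ps) (hp : ps < p) (hδs : 0 < δs)
    (x y : ℝ≥0∞) : x ^ ps * y ^ δs ≤ x ^ p + y ^ (δs * (p / (p - ps))) := by
  have hd : 0 < p - ps := by linarith
  rcases le_total (y ^ δs) (x ^ (p - ps)) with h | h
  · calc x ^ ps * y ^ δs ≤ x ^ ps * x ^ (p - ps) := by gcongr
      _ = x ^ p := by rw [← ENNReal.rpow_add_of_nonneg _ _ hps.le hd.le, add_sub_cancel]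
      _ ≤ _ := le_self_add
  · have hx : x ≤ y ^ (δs / (p - ps)) := by
      rw [div_eq_mul_inv, ENNReal.rpow_mul, ENNReal.le_rpow_inv_iff hd]
      exact h
    calc x ^ ps * y ^ δs ≤ (y ^ (δs / (p - ps))) ^ ps * y ^ δs := by gcongr
      _ = y ^ (δs * (p / (p - ps))) := by
          rw [← ENNReal.rpow_mul, ← ENNReal.rpow_add_of_nonneg _ _ (by positivity) hδs.le]
          congr 1
          field_simp
          ring
      _ ≤ _ := le_add_self

theorem lintegral_rpow_mul_rpow_le {p q : Rn n → ℝ} {ps δs : ℝ} (hpm : Measurable p)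
    (hps : 0 < ps) (hp : ∀ᵐ x, ps < p x) (hδs : 0 < δs)
    (hq : ∀ᵐ x, q x = δs * (p x / (p x - ps))) {φ V : Rn n → ℝ≥0∞} (hφ : Measurable φ) :
    ∫⁻ x, φ x ^ ps * V x ^ δs ≤ modular p φ + ∫⁻ x, V x ^ q x := by
  rw [modular, ← lintegral_add_left (hφ.pow hpm)]
  refine lintegral_mono_ae ?_
  filter_upwards [hp, hq] with x h1 h2
  rw [h2]
  exact rpow_mul_rpow_le_add hps h1 hδs _ _

theorem lintegral_rpow_mul_eq_div {ps : ℝ} (hps : 0 < ps) {t : ℝ} (ht : 0 < t)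
    (φ u : Rn n → ℝ≥0∞) : ∫⁻ x, φ x ^ ps * u x =
      ENNReal.ofReal t ^ ps * ∫⁻ x, (φ x / ENNReal.ofReal t) ^ ps * u x := by
  rw [← lintegral_const_mul' _ _ (ENNReal.rpow_ne_top_of_nonneg hps.le ENNReal.ofReal_ne_top)]
  congr 1 with x
  rw [← mul_assoc, ← ENNReal.mul_rpow_of_nonneg _ _ hps.le,
    ENNReal.mul_div_cancel (by simpa using ht) ENNReal.ofReal_ne_top]

theorem MaximalBounded.exists_const {q : Rn n → ℝ} (hM : MaximalBounded q)
    (hq : ∀ᵐ x, 0 ≤ q x) :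
    ∃ C : ℝ≥0, C ≠ 0 ∧ ∀ h : Rn n → ℝ≥0∞, Measurable h → ∫⁻ x, h x ^ q x ≤ 1 →
      ∫⁻ x, (maximal h x / C) ^ q x ≤ 1 := by
  obtain ⟨C, hC⟩ := hM
  -- The norm is then strictly below the constant, so the infimum need not be attained.
  refine ⟨C + 1, by simp, fun h hh h1 => ?_⟩
  have h1' : modular q (fun x => h x / ENNReal.ofReal 1) ≤ 1 := by simpa [modular] using h1
  refine modular_le_one_of_lpNorm_lt hq ?_
  calc lpNorm q (maximal h) ≤ C * lpNorm q h :=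
        hC h ⟨hh, 1, one_pos, h1'.trans_lt ENNReal.one_lt_top⟩
    _ ≤ C * 1 := by gcongr; simpa using lpNorm_le_ofReal one_pos h1'
    _ < (C + 1 : ℝ≥0) := by
        rw [mul_one]
        exact_mod_cast lt_add_one C

/-- Duality and the Rubio de Francia algorithm in `L^{q(·)}`: functions of modular between `1` and
`m` are tested against powers of `A₁` weights. -/
theorem exists_isA1_test {p q : Rn n → ℝ} (hpm : Measurable p) (hqm : Measurable q) {ps δs : ℝ}
    (hps : 0 < ps) (hp : ∀ᵐ x, ps < p x) (hδs : 0 < δs)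
    (hq : ∀ᵐ x, q x = δs * (p x / (p x - ps))) (hq1 : ∀ᵐ x, 1 ≤ q x) {C : ℝ≥0} (hC0 : C ≠ 0)
    (hC : ∀ h : Rn n → ℝ≥0∞, Measurable h → ∫⁻ x, h x ^ q x ≤ 1 →
      ∫⁻ x, (maximal h x / C) ^ q x ≤ 1) {m : ℝ≥0∞} (hm1 : 1 ≤ m) (hm : m ≠ ∞)
    {φ : Rn n → ℝ≥0∞} (hφ : Measurable φ) (hφ1 : 1 ≤ modular p φ) (hφm : modular p φ ≤ m) :
    ∃ V : Rn n → ℝ≥0∞, IsA1 (2 * C) V ∧ ∫⁻ x, V x ^ q x ≤ 1 ∧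
      1 ≤ (2 * m) ^ δs * ∫⁻ x, φ x ^ ps * V x ^ δs := by
  have hm0 : m ≠ 0 := (zero_lt_one.trans_le hm1).ne'
  -- The dual function: `(p x - ps) / δs * q x = p x`, so `k ^ q = m⁻¹ ^ q * φ ^ p ≤ m⁻¹ * φ ^ p`,
  -- as `1 ≤ m` and `1 ≤ q`.
  let k : Rn n → ℝ≥0∞ := fun x => φ x ^ ((p x - ps) / δs) / m
  have hkm : Measurable k := (hφ.pow ((hpm.sub_const _).div_const _)).div_const _
  have hφk : ∀ x, φ x ^ (p x - ps) = (m * k x) ^ δs := by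
    intro x
    simp only [k]
    rw [ENNReal.mul_div_cancel hm0 hm, ← ENNReal.rpow_mul, div_mul_cancel₀ _ hδs.ne']
  have hφp : ∀ᵐ x, φ x ^ p x = φ x ^ ps * (m * k x) ^ δs := by
    filter_upwards [hp] with x hx
    rw [← hφk, ← ENNReal.rpow_add_of_nonneg _ _ hps.le (by linarith), add_sub_cancel]
  have hki : ∫⁻ x, k x ^ q x ≤ 1 := by
    calc ∫⁻ x, k x ^ q x ≤ ∫⁻ x, m⁻¹ * φ x ^ p x := by
          refine lintegral_mono_ae ?_
          filter_upwards [hp, hq, hq1] with x h1 h2 h3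
          have hd : p x - ps ≠ 0 := by linarith
          simp only [k]
          rw [div_eq_mul_inv, ENNReal.mul_rpow_of_nonneg _ _ (by linarith), ← ENNReal.rpow_mul,
            mul_comm]
          have e1 : (p x - ps) / δs * q x = p x := by rw [h2]; field_simp
          rw [e1]
          gcongr
          exact ENNReal.rpow_le_self_of_le_one (ENNReal.inv_le_one.2 hm1) h3
      _ = m⁻¹ * modular p φ := lintegral_const_mul' _ _ (ENNReal.inv_ne_top.2 hm0)
      _ ≤ m⁻¹ * m := by gcongr
      _ ≤ 1 := ENNReal.inv_mul_le_one _
  obtain ⟨V, hVm, hkV, hVi, hVM⟩ := exists_rubioDeFrancia hqm hq1 hC0 hC hkm hki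
  refine ⟨V, ⟨hVm, ?_, ?_, hVM⟩, hVi, ?_⟩
  · refine ne_zero_of_maximal_le hVm hVM fun h0 => ?_
    have : modular p φ = 0 := by
      rw [modular, lintegral_eq_zero_iff (hφ.pow hpm)]
      filter_upwards [h0, hφp] with x h1 h2
      have h3 : k x = 0 := by
        have := hkV x
        rw [h1] at this
        simpa using this
      rw [h2, h3]
      simp [hδs]
    rw [this] at hφ1
    exact absurd hφ1 (by simp)
  · filter_upwards [ae_lt_top (hVm.pow hqm) (hVi.trans_lt ENNReal.one_lt_top).ne, hq1] with x h1 h2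
      h3
    rw [h3, ENNReal.top_rpow_of_pos (by linarith)] at h1
    exact lt_irrefl _ h1
  · calc 1 ≤ modular p φ := hφ1
      _ ≤ ∫⁻ x, (2 * m) ^ δs * (φ x ^ ps * V x ^ δs) := by
          refine lintegral_mono_ae ?_
          filter_upwards [hφp] with x hx
          rw [hx, mul_left_comm, ← ENNReal.mul_rpow_of_nonneg _ _ hδs.le]
          refine mul_le_mul_right (ENNReal.rpow_le_rpow ?_ hδs.le) _
          calc m * k x ≤ m * (2 * V x) := by gcongr; exact hkV x
            _ = 2 * m * V x := by ring
      _ = _ := lintegral_const_mul' _ _ (ENNReal.rpow_ne_top_of_nonneg hδs.le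
          (ENNReal.mul_ne_top (by simp) hm))

end VarLebesgue

/-! ### Extrapolation to the variable exponent -/

theorem corollary1p6 (n : ℕ) (hn : 1 ≤ n)
    (F : Set ((VarLebesgue.Rn n → ℝ≥0∞) × (VarLebesgue.Rn n → ℝ≥0∞)))
    (hF : ∀ f g : VarLebesgue.Rn n → ℝ≥0∞, (f, g) ∈ F → Measurable f ∧ Measurable g)
    (δ p₀ : ℝ) (hδ₀ : 0 < δ) (hδ₁ : δ < 1) (hp₀ : 1 < p₀)
    (hineq : VarLebesgue.WeightedIneq F p₀ δ)
    (p : VarLebesgue.Rn n → ℝ) (hp : Measurable p)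
    (ps δs : ℝ) (hps : p₀ / (1 + δ * (p₀ - 1)) < ps)
    (hpm : ENNReal.ofReal ps < VarLebesgue.pMinus p)
    (hpp : VarLebesgue.pPlus p < ENNReal.ofReal (p₀ / (1 - δ)))
    (hδs : δs = (p₀ - ps * (1 - δ)) / p₀)
    (hM : VarLebesgue.MaximalBounded (fun x => δs * (p x / ps).conjExponent)) :
    ∃ C : ℝ≥0, ∀ f g : VarLebesgue.Rn n → ℝ≥0∞, (f, g) ∈ F → VarLebesgue.MemLpVar p f →
      VarLebesgue.lpNorm p f ≤ C * VarLebesgue.lpNorm p g := by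
  open VarLebesgue in
  have hp1 : 0 < p₀ - 1 := by linarith
  have hps0 : 0 < ps := lt_trans (by positivity) hps
  have hδ1 : 0 < 1 - δ := by linarith
  set P := p₀ / (1 - δ) with hP
  have hps_lt : ∀ᵐ x, ps < p x := by
    filter_upwards [ae_essInf_le (f := fun x => ENNReal.ofReal (p x))] with x hx
    exact (ENNReal.ofReal_lt_ofReal_iff'.1 (hpm.trans_le hx)).1
  have hlt_P : ∀ᵐ x, p x < P := by
    filter_upwards [ENNReal.ae_le_essSup (fun x => ENNReal.ofReal (p x))] with x hx
    exact (ENNReal.ofReal_lt_ofReal_iff'.1 (hx.trans_lt hpp)).1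
  have hpsP : ps < P := by
    obtain ⟨x, h1, h2⟩ := (hps_lt.and hlt_P).exists
    exact h1.trans h2
  have hP0 : 0 < P := hps0.trans hpsP
  have hδs0 : 0 < δs := by
    rw [hP, lt_div_iff₀ hδ1] at hpsP
    rw [hδs]
    apply div_pos <;> linarith
  set q : Rn n → ℝ := fun x => δs * (p x / ps).conjExponent with hq
  have hqm : Measurable q :=
    (((hp.div_const ps).div ((hp.div_const ps).sub_const 1))).const_mul δs
  have hqeq : ∀ᵐ x, q x = δs * (p x / (p x - ps)) := by
    filter_upwards [hps_lt] with x hx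
    have : p x - ps ≠ 0 := by linarith
    have : p x / ps - 1 ≠ 0 := by
      rw [div_sub_one hps0.ne']
      positivity
    simp only [hq, conjExponent_eq]
    congr 1
    field_simp
  -- With denominators cleared this reads `p x * (1 - δ) ≤ p₀`, so the upper bound on `p` supplies
  -- the convexity needed by the iteration.
  have hq1 : ∀ᵐ x, 1 ≤ q x := by
    filter_upwards [hps_lt, hlt_P, hqeq] with x h1 h2 h3
    rw [hP, lt_div_iff₀ hδ1] at h2
    have hd : 0 < p x - ps := by linarith
    have hp0 : 0 < p₀ := by linarith
    rw [h3, ← mul_div_assoc, le_div_iff₀ hd, hδs, div_mul_eq_mul_div, le_div_iff₀ hp0]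
    nlinarith
  obtain ⟨C₁, hC₁0, hC₁⟩ := hM.exists_const (hq1.mono fun x hx => zero_le_one.trans hx)
  obtain ⟨C₂, hC₂⟩ := exists_extrapolation hF hineq hδ₀ hδ₁ hp₀ hps hpsP hδs (2 * C₁)
  set m : ℝ≥0∞ := 2 ^ P with hm
  have hm_top : m ≠ ∞ := ENNReal.rpow_ne_top_of_nonneg hP0.le (by simp)
  have hm1 : 1 ≤ m := ENNReal.one_le_rpow (by norm_num) hP0
  let D : ℝ≥0∞ := 2 * ((2 * m) ^ δs * (C₂ * 2)) ^ ps⁻¹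
  have hD : D ≠ ∞ := by
    refine ENNReal.mul_ne_top (by simp) (ENNReal.rpow_ne_top_of_nonneg (by positivity)
      (ENNReal.mul_ne_top (ENNReal.rpow_ne_top_of_nonneg hδs0.le (ENNReal.mul_ne_top (by simp)
        hm_top)) (ENNReal.mul_ne_top ENNReal.coe_ne_top (by simp))))
  refine ⟨D.toNNReal + 1, fun f g hfg hf => ?_⟩
  obtain ⟨hfm, hgm⟩ := hF f g hfg
  have hDle : D ≤ ((D.toNNReal + 1 : ℝ≥0) : ℝ≥0∞) := by
    rw [ENNReal.coe_add, ENNReal.coe_toNNReal hD]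
    exact le_self_add
  have hD0 : ((D.toNNReal + 1 : ℝ≥0) : ℝ≥0∞) ≠ 0 := by simp
  by_cases hf0 : lpNorm p f = 0
  · rw [hf0]
    exact zero_le
  have hfin := lpNorm_ne_top hps0 hps_lt hf
  rw [← ENNReal.div_le_iff' hD0 ENNReal.coe_ne_top]
  refine le_iInf fun s => le_iInf₂ fun hs hgs => ?_
  rw [ENNReal.div_le_iff' hD0 ENNReal.coe_ne_top]
  refine le_trans ?_ (mul_le_mul_left hDle _)
  set Λ := (lpNorm p f).toReal with hΛ
  have hΛ0 : 0 < Λ := ENNReal.toReal_pos hf0 hfin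
  have hΛeq : lpNorm p f = ENNReal.ofReal Λ := (ENNReal.ofReal_toReal hfin).symm
  -- Any factor strictly between `1/2` and `1` serves: `T < Λ` makes the modular at scale `T` at
  -- least `1`, and `Λ < 2 * T` makes it at most `1` at scale `2 * T`, hence at most `2 ^ P` at
  -- scale `T`.
  set T := 3 / 4 * Λ with hT
  have hT0 : 0 < T := by positivity
  have hφ1 : 1 ≤ modular p (fun x => f x / ENNReal.ofReal T) := by
    by_contra hcon
    have h1 := lpNorm_le_ofReal hT0 (not_le.1 hcon).le
    rw [hΛeq, ENNReal.ofReal_le_ofReal_iff hT0.le] at h1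
    linarith
  have hφm : modular p (fun x => f x / ENNReal.ofReal T) ≤ m := by
    have hle : lpNorm p f < 2 * ENNReal.ofReal T := by
      rw [hΛeq, ← ENNReal.ofReal_ofNat, ← ENNReal.ofReal_mul (by norm_num),
        ENNReal.ofReal_lt_ofReal_iff (by positivity)]
      linarith
    have h1 := modular_le_one_of_lpNorm_lt (hps_lt.mono fun x hx => (hps0.trans hx).le) hle
    calc modular p (fun x => f x / ENNReal.ofReal T)
        ≤ ∫⁻ x, m * (f x / (2 * ENNReal.ofReal T)) ^ p x := by
          refine lintegral_mono_ae ?_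
          filter_upwards [hps_lt, hlt_P] with x h2 h3
          have hpx : 0 ≤ p x := by linarith
          calc (f x / ENNReal.ofReal T) ^ p x = (2 * (f x / (2 * ENNReal.ofReal T))) ^ p x := by
                rw [← mul_div_assoc, ENNReal.mul_div_mul_left _ _ (by simp) (by simp)]
            _ = 2 ^ p x * (f x / (2 * ENNReal.ofReal T)) ^ p x :=
                ENNReal.mul_rpow_of_nonneg _ _ hpx
            _ ≤ _ := by
                gcongr
                exact ENNReal.rpow_le_rpow_of_exponent_le (by norm_num) h3.le
      _ = m * modular p (fun x => f x / (2 * ENNReal.ofReal T)) :=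
          lintegral_const_mul' _ _ hm_top
      _ ≤ m * 1 := by gcongr
      _ = m := mul_one m
  obtain ⟨V, hV, hVi, hV1⟩ := exists_isA1_test hp hqm hps0 hps_lt hδs0 hqeq hq1 hC₁0 hC₁ hm1
    hm_top (hfm.div_const _) hφ1 hφm
  have hX : ∫⁻ x, f x ^ ps * V x ^ δs < ∞ := by
    rw [lintegral_rpow_mul_eq_div hps0 hT0]
    refine ENNReal.mul_lt_top (ENNReal.rpow_ne_top_of_nonneg hps0.le
      ENNReal.ofReal_ne_top).lt_top ?_
    refine (lintegral_rpow_mul_rpow_le hp hps0 hps_lt hδs0 hqeq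
      (hfm.div_const (ENNReal.ofReal T))).trans_lt ?_
    exact ENNReal.add_lt_top.2 ⟨hφm.trans_lt hm_top.lt_top, hVi.trans_lt ENNReal.one_lt_top⟩
  have hY : ∫⁻ x, g x ^ ps * V x ^ δs ≤ ENNReal.ofReal s ^ ps * 2 := by
    rw [lintegral_rpow_mul_eq_div hps0 hs]
    gcongr
    refine (lintegral_rpow_mul_rpow_le hp hps0 hps_lt hδs0 hqeq
      (hgm.div_const (ENNReal.ofReal s))).trans ?_
    exact (add_le_add (by exact hgs) hVi).trans_eq one_add_one_eq_two
  have hTs : ENNReal.ofReal T ^ ps ≤ (2 * m) ^ δs * (C₂ * 2) * ENNReal.ofReal s ^ ps := by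
    calc ENNReal.ofReal T ^ ps = ENNReal.ofReal T ^ ps * 1 := (mul_one _).symm
      _ ≤ ENNReal.ofReal T ^ ps *
          ((2 * m) ^ δs * ∫⁻ x, (f x / ENNReal.ofReal T) ^ ps * V x ^ δs) := by gcongr
      _ = (2 * m) ^ δs * ∫⁻ x, f x ^ ps * V x ^ δs := by
          rw [lintegral_rpow_mul_eq_div hps0 hT0 f]
          ring
      _ ≤ (2 * m) ^ δs * (C₂ * (ENNReal.ofReal s ^ ps * 2)) := by
          gcongr
          exact (hC₂ V hV f g hfg hX).trans (by gcongr)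
      _ = _ := by ring
  calc lpNorm p f ≤ 2 * ENNReal.ofReal T := by
        rw [hΛeq, ← ENNReal.ofReal_ofNat, ← ENNReal.ofReal_mul (by norm_num)]
        exact ENNReal.ofReal_le_ofReal (by linarith)
    _ ≤ 2 * ((2 * m) ^ δs * (C₂ * 2) * ENNReal.ofReal s ^ ps) ^ ps⁻¹ := by
        gcongr
        rwa [ENNReal.le_rpow_inv_iff hps0]
    _ = D * ENNReal.ofReal s := by
        rw [ENNReal.mul_rpow_of_nonneg _ _ (by positivity), ← ENNReal.rpow_mul,
          mul_inv_cancel₀ hps0.ne', ENNReal.rpow_one, ← mul_assoc]
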